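/- Let $F$ be a germ of biholomorphism of $\mathbb C^n$ fixing the origin $O$, whose differential at $O$ is diagonalizable with eigenvalues $\lambda_1,\dots,\lambda_n$ (listed with multiplicity), and let $1\le r\le n$. A resonance is a pair $(j,L)$ with $L\in\mathbb N^n$, $|L|\ge 2$ and $\lambda_j=\lambda^L$. Suppose that $F$ is 2-resonant with respect to $\lambda_1,\dots,\lambda_r$: there are $P,Q\in\mathbb N^r\times\{0\}^{n-r}$, linearly independent over $\mathbb Q$, such that the resonances $(j,L)$ with $1\le j\le r$ are precisely those with $L=e_j+k_1P+k_2Q$, $k_1,k_2\in\mathbb N$, $k_1+k_2\ge 1$. Suppose that $|\lambda_j|=1$ for $j\le r$ and $|\lambda_j|<1$ for $j>r$. For $l$ large, $F$ is holomorphically conjugate to a germ in approximate Poincaré–Dulac normal form $$\widetilde F(z)=Dz+\sum_{s=1}^r\sum_{|k_1P+k_2Q|\ge 2}a_{(k_1,k_2),s}\,z^{k_1P+k_2Q}z_s e_s+\sum_{s=r+1}^nR_s(z)e_s+O(\|z\|^l),$$ where $D=\mathrm{Diag}(\lambda_1,\dots,\lambda_n)$ and $R_s(z)=O(\|z\|^2)$.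 Suppose that the weighted order of $F$, i.e. the least $k_0=k_1+k_2\ge 1$ such that $a_{(k_1,k_2),s}\ne 0$ for some $s\le r$, is finite (with $l$ large enough for the form to contain all terms of weight $k_1+k_2\le k_0$). The associated parabolic shadow of $F$ is the map $f(u)=u+H_{k_0+1}(u)$ of $\mathbb C^2$, where $H_{k_0+1}=(Q_1,Q_2)$, $$Q_1(u)=u_1\sum_{k_1+k_2=k_0}\Big(\sum_{j=1}^r p_j\frac{a_{(k_1,k_2),j}}{\lambda_j}\Big)u_1^{k_1}u_2^{k_2},\qquad Q_2(u)=u_2\sum_{k_1+k_2=k_0}\Big(\sum_{j=1}^r q_j\frac{a_{(k_1,k_2),j}}{\lambda_j}\Big)u_1^{k_1}u_2^{k_2}.$$ Suppose that, for some such parabolic shadow $f$ of $F$, there is a vector $v\in\mathbb C^2\setminus\{0\}$ such that 1. $v$ is a normalized non-degenerate characteristic direction of $f$: $H_{k_0+1}(v)=-\frac1{k_0}v$; 2. $F$ is $(f,v)$-irregular-nondegenerate: the direction $[v]=[1:u_0]$ is irregular, i.e. the orders of vanishing $\mu_1,\mu_2\in\mathbb N$ at $u_0$ of $g_1(u)=Q_1(1,u)$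 and $g_2(u)=Q_2(1,u)-uQ_1(1,u)$ (in particular $g_2\not\equiv 0$) satisfy $\mu_2>\mu_1+1$; for $[v]=[0:1]$ the same is required after exchanging the two coordinates of $\mathbb C^2$; 3. $F$ is $(f,v)$-parabolically-attracting: $$\mathrm{Re}\Big(\sum_{k_1+k_2=k_0}\frac{a_{(k_1,k_2),j}}{\lambda_j}v_1^{k_1}v_2^{k_2}\Big)<0\qquad\text{for } j=1,\dots,r.$$ Then $F$ has a basin of attraction with $O$ on its boundary: inside every neighbourhood of $O$ there is a non-empty open set $V$ such that $O\in\partial V$, $F(V)\subseteq V$, and $F^{\circ m}(z)\to O$ as $m\to\infty$ for every $z\in V$. -/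

import Mathlib

open Filter Topology Asymptotics

noncomputable section

namespace TwoResonant

/-- Representatives of elements of `Diff(ℂⁿ, O)`: `F` is holomorphic near the origin, fixes it and
has a holomorphic local inverse there. Only the germ of `F` at `0` matters. -/
def IsGermBiholo {n : ℕ} (F : (Fin n → ℂ) → (Fin n → ℂ)) : Prop :=
  F 0 = 0 ∧ AnalyticAt ℂ F 0 ∧
    ∃ G : (Fin n → ℂ) → (Fin n → ℂ), G 0 = 0 ∧ AnalyticAt ℂ G 0 ∧
      (∀ᶠ z in 𝓝 0, G (F z) = z) ∧ ∀ᶠ z in 𝓝 0, F (G z) = z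

/-- The differential of `F` at the origin is diagonalizable, and `lam 0, …, lam (n - 1)` are its
eigenvalues, listed with multiplicity. -/
def HasEigenvalues {n : ℕ} (F : (Fin n → ℂ) → (Fin n → ℂ)) (lam : Fin n → ℂ) : Prop :=
  ∃ b : Module.Basis (Fin n) ℂ (Fin n → ℂ), ∀ i, fderiv ℂ F 0 (b i) = lam i • b i

/-- The monomial `z ^ L = z₁ ^ l₁ ⋯ zₙ ^ lₙ`. -/
def mono {n : ℕ} (z : Fin n → ℂ) (L : Fin n → ℕ) : ℂ := ∏ i, z i ^ L i

/-- The length `|L| = l₁ + ⋯ + lₙ` of a multi-index. -/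
def len {n : ℕ} (L : Fin n → ℕ) : ℕ := ∑ i, L i

/-- The multi-index `k₁ P + k₂ Q`. -/
def comb {n : ℕ} (P Q : Fin n → ℕ) (k : ℕ × ℕ) : Fin n → ℕ := k.1 • P + k.2 • Q

/-- `(j, L)` is a resonance of `lam`. -/
def IsResonance {n : ℕ} (lam : Fin n → ℂ) (j : Fin n) (L : Fin n → ℕ) : Prop :=
  2 ≤ len L ∧ lam j = mono lam L

/-- `P, Q ∈ ℕ^r × {0}^(n-r)` are linearly independent over `ℚ` and generate the resonances of `lam`
with respect to the first `r` entries: the resonances `(j, L)` with `j` among the first `r` indices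
are precisely those with `L = e_j + k₁ P + k₂ Q`, `k₁ + k₂ ≥ 1`. -/
def AreGenerators {n : ℕ} (lam : Fin n → ℂ) (r : ℕ) (P Q : Fin n → ℕ) : Prop :=
  (∀ i : Fin n, r ≤ i.val → P i = 0 ∧ Q i = 0) ∧
  LinearIndependent ℚ ![fun i => (P i : ℚ), fun i => (Q i : ℚ)] ∧
  ∀ j : Fin n, j.val < r → ∀ L : Fin n → ℕ,
    IsResonance lam j L ↔ ∃ k : ℕ × ℕ, 1 ≤ k.1 + k.2 ∧ L = Pi.single j 1 + comb P Q k

/-- The exponents `k` with `|k₁ P + k₂ Q| ≥ 2` for which `z ^ (k₁ P + k₂ Q) z_s` has degree less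
than `l` (as `P, Q ≠ 0`, such a `k` has `k₁, k₂ < l`). -/
def exponents {n : ℕ} (P Q : Fin n → ℕ) (l : ℕ) : Finset (ℕ × ℕ) :=
  (Finset.range l ×ˢ Finset.range l).filter
    fun k => 2 ≤ len (comb P Q k) ∧ len (comb P Q k) + 1 < l

/-- `Ft` is in Poincaré–Dulac normal form in the first `r` coordinates up to order `l`, with
coefficients `a k s` of `z ^ (k₁ P + k₂ Q) z_s e_s`:
`Ft z = D z + ∑_{s ≤ r} ∑_k a k s z ^ (k₁ P + k₂ Q) z_s e_s + ∑_{s > r} R_s e_s + O(‖z‖ ^ l)` with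
`D = Diag lam` and `R_s = O(‖z‖ ^ 2)`. -/
def IsNormalFormUpTo {n : ℕ} (Ft : (Fin n → ℂ) → (Fin n → ℂ)) (lam : Fin n → ℂ) (r : ℕ)
    (P Q : Fin n → ℕ) (a : ℕ × ℕ → Fin n → ℂ) (l : ℕ) : Prop :=
  (∀ s : Fin n, s.val < r →
    (fun z : Fin n → ℂ =>
      Ft z s - (lam s * z s + ∑ k ∈ exponents P Q l, a k s * mono z (comb P Q k) * z s))
      =O[𝓝 0] fun z => ‖z‖ ^ l) ∧
  ∀ s : Fin n, r ≤ s.val → (fun z : Fin n → ℂ => Ft z s - lam s * z s) =O[𝓝 0] fun z => ‖z‖ ^ 2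

/-- `F` has weighted order `k₀ < ∞`, and the `a k s` with `k₁ + k₂ = k₀` are the coefficients of
weight `k₀` in some approximate Poincaré–Dulac normal form of `F`: a holomorphic change of
coordinates `ψ` takes `F` to a germ `Ft` in normal form up to an order `l` that is large enough to
see all the terms of weight at most `k₀`, the coefficients of weight less than `k₀` vanish, and some
coefficient of weight `k₀` does not. -/
def IsShadowData {n : ℕ} (F : (Fin n → ℂ) → (Fin n → ℂ)) (lam : Fin n → ℂ) (r : ℕ)
    (P Q : Fin n → ℕ) (k₀ : ℕ) (a : ℕ × ℕ → Fin n → ℂ) : Prop :=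
  1 ≤ k₀ ∧
  (∃ (l : ℕ) (ψ Ft : (Fin n → ℂ) → (Fin n → ℂ)),
    (∀ k : ℕ × ℕ, k.1 + k.2 ≤ k₀ → len (comb P Q k) + 1 < l) ∧
    IsGermBiholo ψ ∧ IsGermBiholo Ft ∧ (∀ᶠ z in 𝓝 0, ψ (F z) = Ft (ψ z)) ∧
    IsNormalFormUpTo Ft lam r P Q a l) ∧
  (∀ k : ℕ × ℕ, 1 ≤ k.1 + k.2 → k.1 + k.2 < k₀ → ∀ s : Fin n, s.val < r → a k s = 0) ∧
  ∃ k : ℕ × ℕ, k.1 + k.2 = k₀ ∧ ∃ s : Fin n, s.val < r ∧ a k s ≠ 0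

/-- `∑_{k₁ + k₂ = k₀} (a k j / lam j) u₁ ^ k₁ u₂ ^ k₂`. -/
def fiberTerm {n : ℕ} (lam : Fin n → ℂ) (k₀ : ℕ) (a : ℕ × ℕ → Fin n → ℂ) (j : Fin n)
    (u : ℂ × ℂ) : ℂ :=
  ∑ k ∈ Finset.HasAntidiagonal.antidiagonal k₀, a k j / lam j * u.1 ^ k.1 * u.2 ^ k.2

/-- The homogeneous map `H_{k₀+1}` of degree `k₀ + 1` of `ℂ²`; the parabolic shadow with data
`k₀`, `a` is `f u = u + H_{k₀+1} u`. -/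
def shadowTerm {n : ℕ} (lam : Fin n → ℂ) (r : ℕ) (P Q : Fin n → ℕ) (k₀ : ℕ)
    (a : ℕ × ℕ → Fin n → ℂ) (u : ℂ × ℂ) : ℂ × ℂ :=
  (u.1 * ∑ k ∈ Finset.HasAntidiagonal.antidiagonal k₀,
      (∑ j : Fin n with j.val < r, (P j : ℂ) * (a k j / lam j)) * u.1 ^ k.1 * u.2 ^ k.2,
   u.2 * ∑ k ∈ Finset.HasAntidiagonal.antidiagonal k₀,
      (∑ j : Fin n with j.val < r, (Q j : ℂ) * (a k j / lam j)) * u.1 ^ k.1 * u.2 ^ k.2)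

/-- `v` is a normalized non-degenerate characteristic direction of `id + H`, where `H` is
homogeneous of degree `k₀ + 1`. -/
def IsNormalizedDirection (H : ℂ × ℂ → ℂ × ℂ) (k₀ : ℕ) (v : ℂ × ℂ) : Prop :=
  v ≠ 0 ∧ H v = (-(1 / (k₀ : ℂ))) • v

/-- The direction `(1, u₀)` is irregular for `id + H`, `H = (Q₁, Q₂)`: the (finite) orders of
vanishing `μ₁`, `μ₂` at `u₀` of `g₁ u = Q₁ (1, u)` and `g₂ u = Q₂ (1, u) - u Q₁ (1, u)` satisfy
`μ₂ > μ₁ + 1`. -/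
def IsIrregularAt (H : ℂ × ℂ → ℂ × ℂ) (u₀ : ℂ) : Prop :=
  analyticOrderAt (fun u : ℂ => (H (1, u)).2 - u * (H (1, u)).1) u₀ ≠ ⊤ ∧
  analyticOrderAt (fun u : ℂ => (H (1, u)).1) u₀ + 1 <
    analyticOrderAt (fun u : ℂ => (H (1, u)).2 - u * (H (1, u)).1) u₀

/-- The direction `[v]` is irregular for `id + H`. The direction `[0 : 1]` is treated by exchanging
the two coordinates of `ℂ²`. -/
def IsIrregularDirection (H : ℂ × ℂ → ℂ × ℂ) (v : ℂ × ℂ) : Prop :=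
  (v.1 ≠ 0 ∧ IsIrregularAt H (v.2 / v.1)) ∨
  (v.1 = 0 ∧ v.2 ≠ 0 ∧ IsIrregularAt (fun w => (H w.swap).swap) 0)

/-- `F` is `(f, v)`-irregular-nondegenerate, for the parabolic shadow `f` with data `k₀`, `a`. -/
def IsIrregularNondegenerate {n : ℕ} (lam : Fin n → ℂ) (r : ℕ) (P Q : Fin n → ℕ) (k₀ : ℕ)
    (a : ℕ × ℕ → Fin n → ℂ) (v : ℂ × ℂ) : Prop :=
  IsNormalizedDirection (shadowTerm lam r P Q k₀ a) k₀ v ∧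
  IsIrregularDirection (shadowTerm lam r P Q k₀ a) v

/-- `F` is `(f, v)`-parabolically-attracting with respect to the first `r` eigenvalues, for the
parabolic shadow `f` with data `k₀`, `a`. -/
def IsParabolicallyAttracting {n : ℕ} (lam : Fin n → ℂ) (r : ℕ) (P Q : Fin n → ℕ) (k₀ : ℕ)
    (a : ℕ × ℕ → Fin n → ℂ) (v : ℂ × ℂ) : Prop :=
  IsNormalizedDirection (shadowTerm lam r P Q k₀ a) k₀ v ∧
  ∀ j : Fin n, j.val < r → (fiberTerm lam k₀ a j v).re < 0

/-- `V` is a basin of attraction of `F` at the origin with the origin on its boundary. -/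
def IsBasinAtBoundary {n : ℕ} (F : (Fin n → ℂ) → (Fin n → ℂ)) (V : Set (Fin n → ℂ)) : Prop :=
  IsOpen V ∧ V.Nonempty ∧ (0 : Fin n → ℂ) ∈ frontier V ∧ Set.MapsTo F V V ∧
    ∀ z ∈ V, Tendsto (fun m : ℕ => F^[m] z) atTop (𝓝 0)

end TwoResonant

end

noncomputable section

namespace TwoResonant

/-! Push the dynamics to the pair of resonant monomials `U = (z^P, z^Q)`. Poincaré–Dulac
normalization, continued from the given normal form to any order `l` without changing its terms of
weight at most `k₀`, makes each of the first `r` coordinates evolve as `z_s ↦ z_s (λ_s + q_s(U)) +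
O(‖z‖^l)`. Since `λ^P = λ^Q = 1`, the pair `U` then follows the parabolic shadow up to `O(‖U‖^(k₀+2)
+ ‖z‖^l)` (`exists_isShadowed`).

With `k = k₀`, blow up at `[v]`: put `x = z^P / v₁` and `y = z^Q / z^P - v₂ / v₁`. Irregularity
forces `g₂` to vanish to some order `σ + 1 ≥ 2`, and up to small relative errors the map reads `x ↦
x (1 - x^k / k)`, `y ↦ y (1 + C x^k y^σ)` with `C ≠ 0`. Then `x^(-k)` grows by about `1`, while `-1
/ (σ C y^σ)` moves by about `x^k`, which has positive real part. Hence a region where both have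
large real part, the first lying in a thin sector, is kept by the map (`petal_step`). The extra
condition `‖x‖ < ε ‖y‖^(σ+1)` makes the error terms negligible in the equation for `y`; it persists
because `y` is much slower than `x`.

The error `‖z‖^l` is controlled by the condition `‖z‖^N < ‖x‖`. Parabolic attraction together with
`|λ_j| < 1` for `j > r` shrinks `‖z‖` by a factor `1 - c |x|^k`, while `‖x‖` loses at most a factor
`1 - 2 |x|^k`; for `N` large the condition is therefore invariant (`region_step`). Only then is `l`
chosen, with `l ≥ N (k + 2)`.

The region accumulates at the origin: the numbers `α_j = -k Re f_j(v) > 0`, with `f_j` the fiber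
term, satisfy `∑ P_j α_j = ∑ Q_j α_j = 1`, so points with `|z_j|` comparable to `e^(-α_j t)` can be
given prescribed values of `x` and `y` (`frequently_mem_basinRegion`). Growth of `Re x^(-k)` gives
`x → 0`, and `‖z‖^N < ‖x‖` gives `z → 0`. -/

/-! ### Orders of vanishing and homogeneous parts. -/

theorem isBigO_pow_of_le {E : Type*} [NormedAddCommGroup E] {a b : ℕ} (h : a ≤ b) :
    (fun z : E => ‖z‖ ^ b) =O[𝓝 0] fun z => ‖z‖ ^ a := by
  refine IsBigO.of_bound 1 ?_
  filter_upwards [Metric.ball_mem_nhds (0 : E) one_pos] with z hz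
  rw [mem_ball_zero_iff] at hz
  simpa using pow_le_pow_of_le_one (norm_nonneg z) hz.le h

theorem multilinear_eq_sum {n l : ℕ}
    (p : ContinuousMultilinearMap ℂ (fun _ : Fin l => Fin n → ℂ) ℂ) (z : Fin n → ℂ) :
    (p fun _ => z) = ∑ g : Fin l → Fin n, p (fun i => Pi.single (g i) 1) * ∏ i, z (g i) := by
  have hz : (fun _ : Fin l => z) =
      fun _ : Fin l => ∑ j : Fin n, z j • (Pi.single j (1 : ℂ) : Fin n → ℂ) := by
    funext _
    exact pi_eq_sum_univ' z
  rw [hz, p.map_sum]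
  refine Finset.sum_congr rfl fun g _ => ?_
  rw [p.map_smul_univ, smul_eq_mul, mul_comm]

/-- An analytic function vanishing to order `l` at the origin is, up to order `l + 1`, a
homogeneous polynomial of degree `l`. -/
theorem exists_homogeneous_part {n l : ℕ} {f : (Fin n → ℂ) → ℂ} (hf : AnalyticAt ℂ f 0)
    (hO : f =O[𝓝 0] fun z => ‖z‖ ^ l) :
    ∃ h : (Fin l → Fin n) → ℂ,
      (fun z => f z - ∑ g, h g * ∏ i, z (g i)) =O[𝓝 0] fun z => ‖z‖ ^ (l + 1) := by
  obtain ⟨p, hp⟩ := hf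
  -- Terms of degree below `l` vanish inductively: the lowest remaining one is a homogeneous
  -- polynomial of degree `k` that is `O(‖z‖^(k+1))`.
  have hvan : ∀ k, k < l → ∀ z, (p k fun _ => z) = 0 := by
    intro k
    induction k using Nat.strong_induction_on with
    | _ k ih =>
      intro hk
      have h1 := hp.isBigO_sub_partialSum_pow (k + 1)
      have h2 : (fun z => p.partialSum (k + 1) z) =O[𝓝 0] fun z => ‖z‖ ^ (k + 1) := by
        have := (hO.trans (isBigO_pow_of_le (E := Fin n → ℂ) (Nat.succ_le_of_lt hk))).sub h1
        simpa using this
      have h3 : (fun z => p k fun _ => z) =O[𝓝 0] fun z => ‖z‖ ^ (k + 1) := by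
        refine h2.congr_left fun z => ?_
        rw [FormalMultilinearSeries.partialSum, Finset.sum_range_succ, Finset.sum_eq_zero, zero_add]
        intro i hi
        exact ih i (Finset.mem_range.1 hi) ((Finset.mem_range.1 hi).trans hk) z
      exact h3.continuousMultilinearMap_apply_eq_zero
  refine ⟨fun g => p l fun i => Pi.single (g i) 1, ?_⟩
  refine (hp.isBigO_sub_partialSum_pow (l + 1)).congr_left fun z => ?_
  rw [← multilinear_eq_sum, FormalMultilinearSeries.partialSum, Finset.sum_range_succ,
    Finset.sum_eq_zero, zero_add, zero_add]
  intro i hi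
  exact hvan i (Finset.mem_range.1 hi) z

theorem prod_isBigO {E ι : Type*} [NormedAddCommGroup E] (s : Finset ι) {f : ι → E → ℂ}
    (hf : ∀ i, f i =O[𝓝 0] fun z => ‖z‖) :
    (fun z => ∏ i ∈ s, f i z) =O[𝓝 0] fun z => ‖z‖ ^ s.card := by
  classical
  induction s using Finset.induction_on with
  | empty => simpa using isBigO_refl (fun _ : E => (1 : ℂ)) (𝓝 0)
  | insert a s ha ih =>
    simp only [Finset.prod_insert ha, Finset.card_insert_of_notMem ha, pow_succ']
    exact (hf a).mul ih

theorem prod_sub_prod_isBigO {E ι : Type*} [NormedAddCommGroup E] (s : Finset ι) {f g : ι → E → ℂ}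
    (hf : ∀ i, f i =O[𝓝 0] fun z => ‖z‖) (hg : ∀ i, g i =O[𝓝 0] fun z => ‖z‖)
    (hfg : ∀ i, (fun z => f i z - g i z) =O[𝓝 0] fun z => ‖z‖ ^ 2) :
    (fun z => ∏ i ∈ s, f i z - ∏ i ∈ s, g i z) =O[𝓝 0] fun z => ‖z‖ ^ (s.card + 1) := by
  classical
  induction s using Finset.induction_on with
  | empty => simpa using isBigO_zero (fun z : E => ‖z‖) (𝓝 0)
  | insert a s ha ih =>
    simp only [Finset.prod_insert ha, Finset.card_insert_of_notMem ha]
    have h1 := ((hfg a).mul (prod_isBigO s hf)).congr_right (g₂ := fun z => ‖z‖ ^ (s.card + 1 + 1))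
      fun z => by ring
    have h2 := ((hg a).mul ih).congr_right (g₂ := fun z => ‖z‖ ^ (s.card + 1 + 1))
      fun z => by ring
    exact (h1.add h2).congr_left fun z => by ring

theorem isBigO_apply {E : Type*} [NormedAddCommGroup E] {n : ℕ} {f : E → Fin n → ℂ} {g : E → ℝ}
    (h : f =O[𝓝 0] g) (s : Fin n) : (fun z => f z s) =O[𝓝 0] g :=
  (isBigO_pi.1 h) s

/-! ### Monomials and multi-indices. -/

theorem analyticAt_mono {n : ℕ} (L : Fin n → ℕ) (w : Fin n → ℂ) :
    AnalyticAt ℂ (fun w : Fin n → ℂ => mono w L) w := by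
  exact Finset.analyticAt_fun_prod _ fun i _ =>
    ((ContinuousLinearMap.proj (R := ℂ) (φ := fun _ : Fin n => ℂ) i).analyticAt w).pow _

theorem mono_zero {n : ℕ} {L : Fin n → ℕ} (h : L ≠ 0) : mono (0 : Fin n → ℂ) L = 0 := by
  obtain ⟨i, hi⟩ := Function.ne_iff.1 h
  exact Finset.prod_eq_zero (Finset.mem_univ i) (by simpa using hi)

theorem mono_add {n : ℕ} (z : Fin n → ℂ) (L M : Fin n → ℕ) :
    mono z (L + M) = mono z L * mono z M := by
  simp [mono, pow_add, Finset.prod_mul_distrib]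

theorem mono_smul {n : ℕ} (z : Fin n → ℂ) (m : ℕ) (L : Fin n → ℕ) :
    mono z (m • L) = mono z L ^ m := by
  simp only [mono, Pi.smul_apply, smul_eq_mul, ← Finset.prod_pow, ← pow_mul]
  exact Finset.prod_congr rfl fun i _ => by rw [mul_comm]

theorem mono_single {n : ℕ} (z : Fin n → ℂ) (j : Fin n) : mono z (Pi.single j 1) = z j := by
  rw [mono, Finset.prod_eq_single j]
  · simp
  · intro b _ hb; simp [hb]
  · simp

theorem mono_comb {n : ℕ} (z : Fin n → ℂ) (P Q : Fin n → ℕ) (k : ℕ × ℕ) :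
    mono z (comb P Q k) = mono z P ^ k.1 * mono z Q ^ k.2 := by
  rw [comb, mono_add, mono_smul, mono_smul]

/-- The multi-index counting the values of `g`. -/
def count {n l : ℕ} (g : Fin l → Fin n) : Fin n → ℕ :=
  fun j => (Finset.univ.filter fun i => g i = j).card

theorem mono_count {n l : ℕ} (z : Fin n → ℂ) (g : Fin l → Fin n) :
    mono z (count g) = ∏ i, z (g i) := by
  rw [mono, ← Finset.prod_fiberwise (s := Finset.univ) (g := g)]
  refine Finset.prod_congr rfl fun j _ => ?_
  rw [Finset.prod_congr rfl (g := fun _ => z j), Finset.prod_const, count]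
  intro i hi
  rw [(Finset.mem_filter.1 hi).2]

theorem len_count {n l : ℕ} (g : Fin l → Fin n) : len (count g) = l := by
  have := Finset.card_eq_sum_card_fiberwise (f := g) (s := Finset.univ) (t := Finset.univ)
    (fun _ _ => Finset.mem_coe.2 (Finset.mem_univ _))
  simpa [len, count] using this.symm

theorem len_add {n : ℕ} (L M : Fin n → ℕ) : len (L + M) = len L + len M := by
  simp [len, Finset.sum_add_distrib]

theorem len_single {n : ℕ} (j : Fin n) : len (Pi.single j 1 : Fin n → ℕ) = 1 := by
  simp [len]

/-! ### Poincaré–Dulac normalization, one degree at a time. -/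

/-- The pair of resonant monomials. -/
def resMono {n : ℕ} (P Q : Fin n → ℕ) (w : Fin n → ℂ) : ℂ × ℂ := (mono w P, mono w Q)

theorem analyticAt_resMono {n : ℕ} (P Q : Fin n → ℕ) (w : Fin n → ℂ) :
    AnalyticAt ℂ (resMono P Q) w := (analyticAt_mono P w).prod (analyticAt_mono Q w)

theorem resMono_zero {n : ℕ} {P Q : Fin n → ℕ} (hP : P ≠ 0) (hQ : Q ≠ 0) :
    resMono P Q 0 = 0 := by
  simp [resMono, mono_zero hP, mono_zero hQ]

/-- Coordinates `Φ`, tangent to the identity, in which `F` is in Poincaré–Dulac normal form up to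
order `l` in the first `r` coordinates, the resonant terms being given by `q`. -/
structure IsReduced {n : ℕ} (F : (Fin n → ℂ) → (Fin n → ℂ)) (lam : Fin n → ℂ) (r : ℕ)
    (P Q : Fin n → ℕ) (q : Fin n → ℂ × ℂ → ℂ) (Φ : (Fin n → ℂ) → (Fin n → ℂ)) (l : ℕ) : Prop where
  analytic : AnalyticAt ℂ Φ 0
  map_zero : Φ 0 = 0
  tangent : (fun z => Φ z - z) =O[𝓝 0] fun z => ‖z‖ ^ 2
  analytic_res : ∀ s, AnalyticAt ℂ (q s) 0
  res_zero : ∀ s, q s 0 = 0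
  normal : ∀ s : Fin n, s.val < r →
    (fun z => Φ (F z) s - Φ z s * (lam s + q s (resMono P Q (Φ z)))) =O[𝓝 0] fun z => ‖z‖ ^ l
  contract : ∀ s : Fin n, r ≤ s.val →
    (fun z => Φ (F z) s - lam s * Φ z s) =O[𝓝 0] fun z => ‖z‖ ^ 2

theorem isBigO_norm_of_analyticAt {E G : Type*} [NormedAddCommGroup E] [NormedSpace ℂ E]
    [NormedAddCommGroup G] [NormedSpace ℂ G] {f : E → G} (hf : AnalyticAt ℂ f 0) (h0 : f 0 = 0) :
    f =O[𝓝 0] fun z => ‖z‖ := by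
  simpa [h0] using! hf.differentiableAt.isBigO_sub.norm_right

/-- Since `q` vanishes at the origin, the resonant term is of order at least two, so a change of
coordinates of order `l` alters it only at order `l + 1`. This is what makes the homological
equation linear in the correction. -/
theorem resonant_term_sub_isBigO {n l : ℕ} {P Q : Fin n → ℕ} (hP : P ≠ 0) (hQ : Q ≠ 0)
    {Φ Ψ : (Fin n → ℂ) → (Fin n → ℂ)} (hΦ : AnalyticAt ℂ Φ 0) (hΦ0 : Φ 0 = 0)
    (hΨ : AnalyticAt ℂ Ψ 0) (hΨ0 : Ψ 0 = 0)
    (hd : (fun z => Ψ z - Φ z) =O[𝓝 0] fun z => ‖z‖ ^ l)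
    {q : ℂ × ℂ → ℂ} (hq : AnalyticAt ℂ q 0) (hq0 : q 0 = 0) (s : Fin n) :
    (fun z => Ψ z s * q (resMono P Q (Ψ z)) - Φ z s * q (resMono P Q (Φ z)))
      =O[𝓝 0] fun z => ‖z‖ ^ (l + 1) := by
  have hu0 : resMono P Q 0 = 0 := resMono_zero hP hQ
  have hqu : AnalyticAt ℂ (fun w => q (resMono P Q w)) 0 := by
    have h' : AnalyticAt ℂ q (resMono P Q 0) := by rwa [hu0]
    exact h'.comp (analyticAt_resMono P Q 0)
  have hquΨ : AnalyticAt ℂ (fun z => q (resMono P Q (Ψ z))) 0 := by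
    have h' : AnalyticAt ℂ (fun w => q (resMono P Q w)) (Ψ 0) := by rwa [hΨ0]
    exact h'.comp hΨ
  have h1 : (fun z => q (resMono P Q (Ψ z))) =O[𝓝 0] fun z => ‖z‖ :=
    isBigO_norm_of_analyticAt hquΨ (by rw [hΨ0, hu0, hq0])
  have h2 : (fun z => q (resMono P Q (Ψ z)) - q (resMono P Q (Φ z))) =O[𝓝 0] fun z => ‖z‖ ^ l := by
    have hst := hqu.hasStrictFDerivAt.isBigO_sub
    have ht : Tendsto (fun z => (Ψ z, Φ z)) (𝓝 0) (𝓝 ((0 : Fin n → ℂ), (0 : Fin n → ℂ))) := by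
      have := hΨ.continuousAt.prodMk hΦ.continuousAt
      simpa only [ContinuousAt, hΨ0, hΦ0] using this
    exact (hst.comp_tendsto ht).trans hd
  have h3 : (fun z => Φ z s) =O[𝓝 0] fun z => ‖z‖ :=
    isBigO_apply (isBigO_norm_of_analyticAt hΦ hΦ0) s
  have h4 := ((isBigO_apply hd s).mul h1).congr_right (g₂ := fun z => ‖z‖ ^ (l + 1)) fun z => by ring
  have h5 := (h3.mul h2).congr_right (g₂ := fun z => ‖z‖ ^ (l + 1)) fun z => by ring
  refine (h4.add h5).congr_left fun z => ?_
  simp only [Pi.sub_apply]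
  ring

theorem monomial_isBigO (k : ℕ × ℕ) {m : ℕ} (hm : m ≤ k.1 + k.2) :
    (fun u : ℂ × ℂ => u.1 ^ k.1 * u.2 ^ k.2) =O[𝓝 0] fun u => ‖u‖ ^ m := by
  refine IsBigO.trans (IsBigO.of_bound 1 (Eventually.of_forall fun u => ?_))
    (isBigO_pow_of_le (E := ℂ × ℂ) hm)
  rw [norm_mul, norm_pow, norm_pow, one_mul, norm_pow, norm_norm, pow_add]
  gcongr
  · exact norm_fst_le u
  · exact norm_snd_le u

theorem analyticAt_monomial (k : ℕ × ℕ) (u : ℂ × ℂ) :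
    AnalyticAt ℂ (fun u : ℂ × ℂ => u.1 ^ k.1 * u.2 ^ k.2) u := by
  exact (analyticAt_fst.pow _).mul (analyticAt_snd.pow _)

theorem analyticAt_apply {n : ℕ} {E : Type*} [NormedAddCommGroup E] [NormedSpace ℂ E]
    {f : E → Fin n → ℂ} {x : E} (hf : AnalyticAt ℂ f x) (s : Fin n) :
    AnalyticAt ℂ (fun z => f z s) x :=
  ((ContinuousLinearMap.proj (R := ℂ) (φ := fun _ : Fin n => ℂ) s).analyticAt _).comp hf

theorem analyticAt_resonant_term {n : ℕ} {P Q : Fin n → ℕ} (hP : P ≠ 0) (hQ : Q ≠ 0)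
    {Φ : (Fin n → ℂ) → (Fin n → ℂ)} (hΦ : AnalyticAt ℂ Φ 0) (hΦ0 : Φ 0 = 0)
    {q : ℂ × ℂ → ℂ} (hq : AnalyticAt ℂ q 0) : AnalyticAt ℂ (fun z => q (resMono P Q (Φ z))) 0 := by
  have hqu : AnalyticAt ℂ (fun w => q (resMono P Q w)) (Φ 0) := by
    have h' : AnalyticAt ℂ q (resMono P Q (Φ 0)) := by rwa [hΦ0, resMono_zero hP hQ]
    exact h'.comp (analyticAt_resMono P Q (Φ 0))
  exact hqu.comp hΦ

/-- One step of the normalization. Monomials of degree `l` in the defect are indexed by words `g :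
Fin l → Fin n`. A nonresonant one is removed by adding `c / (λ_s - λ^L)` times the monomial to the
coordinate; a resonant one is a monomial in `U` times the coordinate itself and is absorbed into
`q`. The hypothesis `hk` puts every absorbed term in weight above `k₀`, so the shadow does not
change. -/
theorem IsReduced.exists_succ {n r l : ℕ} {F : (Fin n → ℂ) → (Fin n → ℂ)} {lam : Fin n → ℂ}
    {P Q : Fin n → ℕ} {q : Fin n → ℂ × ℂ → ℂ} {Φ : (Fin n → ℂ) → (Fin n → ℂ)}
    (h : IsReduced F lam r P Q q Φ l) (hF : AnalyticAt ℂ F 0) (hF0 : F 0 = 0)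
    (hP : P ≠ 0) (hQ : Q ≠ 0)
    (hres : ∀ j : Fin n, j.val < r → ∀ L : Fin n → ℕ,
      IsResonance lam j L → ∃ k : ℕ × ℕ, 1 ≤ k.1 + k.2 ∧ L = Pi.single j 1 + comb P Q k)
    (hl : 2 ≤ l) {k₀ : ℕ} (hk : ∀ k : ℕ × ℕ, k.1 + k.2 ≤ k₀ → len (comb P Q k) + 1 < l) :
    ∃ q' Φ', IsReduced F lam r P Q q' Φ' (l + 1) ∧
      ∀ s, (fun u => q' s u - q s u) =O[𝓝 0] fun u => ‖u‖ ^ (k₀ + 1) := by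
  classical
  have hΦF : AnalyticAt ℂ (fun z => Φ (F z)) 0 := by
    have : AnalyticAt ℂ Φ (F 0) := by rw [hF0]; exact h.analytic
    exact this.comp hF
  have hE : ∀ s : Fin n, s.val < r → ∃ c : (Fin l → Fin n) → ℂ,
      (fun z => Φ (F z) s - Φ z s * (lam s + q s (resMono P Q (Φ z))) -
        ∑ g, c g * ∏ i, z (g i)) =O[𝓝 0] fun z => ‖z‖ ^ (l + 1) := fun s hs => by
    refine exists_homogeneous_part ?_ (h.normal s hs)
    exact (analyticAt_apply hΦF s).sub ((analyticAt_apply h.analytic s).mul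
      (analyticAt_const.add (analyticAt_resonant_term hP hQ h.analytic h.map_zero
        (h.analytic_res s))))
  choose! c hc using hE
  have hresg : ∀ s : Fin n, s.val < r → ∀ g : Fin l → Fin n, lam s = mono lam (count g) →
      ∃ k : ℕ × ℕ, 1 ≤ k.1 + k.2 ∧ count g = Pi.single s 1 + comb P Q k := fun s hs g hg =>
    hres s hs _ ⟨by rwa [len_count], hg⟩
  choose! κ hκ1 hκ2 using hresg
  set R : Fin n → Finset (Fin l → Fin n) := fun s =>
    if s.val < r then Finset.univ.filter (fun g => lam s = mono lam (count g)) else ∅ with hR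
  set d : Fin n → (Fin l → Fin n) → ℂ := fun s g =>
    if s.val < r then (if lam s = mono lam (count g) then 0 else
      c s g / (lam s - mono lam (count g))) else 0 with hd
  set q' : Fin n → ℂ × ℂ → ℂ := fun s u =>
    q s u + ∑ g ∈ R s, c s g * (u.1 ^ (κ s g).1 * u.2 ^ (κ s g).2) with hq'
  set Φ' : (Fin n → ℂ) → (Fin n → ℂ) := fun z s =>
    Φ z s + ∑ g, d s g * ∏ i, Φ z (g i) with hΦ'
  have hRmem : ∀ s g, g ∈ R s → s.val < r ∧ lam s = mono lam (count g) := by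
    intro s g hg
    by_cases hs : s.val < r
    · simp only [hR, hs, if_true, Finset.mem_filter] at hg
      exact ⟨hs, hg.2⟩
    · simp [hR, hs] at hg
  have hΦ'an : AnalyticAt ℂ Φ' 0 := by
    rw [analyticAt_pi_iff]
    intro s
    refine (analyticAt_apply h.analytic s).add (Finset.analyticAt_fun_sum _ fun g _ => ?_)
    exact analyticAt_const.mul (Finset.analyticAt_fun_prod _ fun i _ =>
      analyticAt_apply h.analytic (g i))
  have hl0 : 0 < l := by omega
  have hΦ'0 : Φ' 0 = 0 := by
    funext s
    simp [hΦ', h.map_zero, hl0.ne']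
  have hΦO : ∀ j, (fun z => Φ z j) =O[𝓝 0] fun z => ‖z‖ := fun j =>
    isBigO_apply (isBigO_norm_of_analyticAt h.analytic h.map_zero) j
  have hq'an : ∀ s, AnalyticAt ℂ (q' s) 0 := fun s =>
    (h.analytic_res s).add (Finset.analyticAt_fun_sum _ fun g _ =>
      analyticAt_const.mul (analyticAt_monomial _ _))
  have hq'0 : ∀ s, q' s 0 = 0 := by
    intro s
    simp only [hq', h.res_zero, zero_add]
    refine Finset.sum_eq_zero fun g hg => ?_
    have := hκ1 s (hRmem s g hg).1 g (hRmem s g hg).2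
    rcases Nat.eq_zero_or_pos (κ s g).1 with h0 | h0
    · have h2 : (κ s g).2 ≠ 0 := by omega
      simp [h2]
    · simp [h0.ne']
  have hsum : ∀ s, (fun z => ∑ g, d s g * ∏ i, Φ z (g i)) =O[𝓝 0] fun z => ‖z‖ ^ l := fun s => by
    refine IsBigO.fun_sum fun g _ => IsBigO.const_mul_left ?_ _
    simpa using prod_isBigO (Finset.univ : Finset (Fin l)) (f := fun i z => Φ z (g i))
      fun i => hΦO (g i)
  have hdiff : (fun z => Φ' z - Φ z) =O[𝓝 0] fun z => ‖z‖ ^ l := by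
    rw [isBigO_pi]
    intro s
    refine (hsum s).congr_left fun z => ?_
    simp [hΦ']
  -- All coordinates, including those beyond `r`, are linear to first order; this suffices to
  -- replace a degree `l` monomial of `Φ (F z)` by `λ^L` times that of `Φ z`.
  have hlin : ∀ s : Fin n, (fun z => Φ (F z) s - lam s * Φ z s) =O[𝓝 0] fun z => ‖z‖ ^ 2 := by
    intro s
    by_cases hs : s.val < r
    · have h1 := (h.normal s hs).trans (isBigO_pow_of_le (E := Fin n → ℂ) hl)
      have h2 := ((hΦO s).mul (isBigO_norm_of_analyticAt (analyticAt_resonant_term hP hQ h.analytic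
        h.map_zero (h.analytic_res s)) (by rw [h.map_zero, resMono_zero hP hQ, h.res_zero])))
      refine (h1.add (h2.congr_right (g₂ := fun z => ‖z‖ ^ 2) fun z => by ring)).congr_left
        fun z => ?_
      ring
    · exact h.contract s (not_lt.1 hs)
  refine ⟨q', Φ', ⟨hΦ'an, hΦ'0, ?_, hq'an, hq'0, ?_, ?_⟩, ?_⟩
  · exact ((hdiff.trans (isBigO_pow_of_le (E := Fin n → ℂ) hl)).add h.tangent).congr_left
      fun z => by simp
  · intro s hs
    have e1 := hc s hs
    have e2 : (fun z => ∑ g, c s g * ∏ i, z (g i) - ∑ g, c s g * ∏ i, Φ z (g i))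
        =O[𝓝 0] fun z => ‖z‖ ^ (l + 1) := by
      simp only [← Finset.sum_sub_distrib, ← mul_sub]
      refine IsBigO.fun_sum fun g _ => IsBigO.const_mul_left ?_ _
      simpa using prod_sub_prod_isBigO (Finset.univ : Finset (Fin l)) (f := fun i z => z (g i))
        (g := fun i z => Φ z (g i))
        (fun i => isBigO_apply (isBigO_norm_right.2 (isBigO_refl _ _)) (g i)) (fun i => hΦO (g i))
        (fun i => (isBigO_apply h.tangent (g i)).neg_left.congr_left fun z => by simp)
    have e3 : (fun z => ∑ g, d s g * ∏ i, Φ (F z) (g i) -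
        ∑ g, d s g * (mono lam (count g) * ∏ i, Φ z (g i)))
        =O[𝓝 0] fun z => ‖z‖ ^ (l + 1) := by
      simp only [← Finset.sum_sub_distrib, ← mul_sub, mono_count, ← Finset.prod_mul_distrib]
      refine IsBigO.fun_sum fun g _ => IsBigO.const_mul_left ?_ _
      simpa using prod_sub_prod_isBigO (Finset.univ : Finset (Fin l))
        (f := fun i z => Φ (F z) (g i)) (g := fun i z => lam (g i) * Φ z (g i))
        (fun i => isBigO_norm_of_analyticAt (analyticAt_apply hΦF (g i))
          (by simp [hF0, h.map_zero]))
        (fun i => (hΦO (g i)).const_mul_left _) (fun i => hlin (g i))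
    have e4 := resonant_term_sub_isBigO hP hQ h.analytic h.map_zero hΦ'an hΦ'0 hdiff
      (hq'an s) (hq'0 s) s
    -- The homological equation, monomial by monomial.
    have key : ∀ z, ∑ g, c s g * ∏ i, Φ z (g i) +
        ∑ g, d s g * (mono lam (count g) * ∏ i, Φ z (g i)) =
        lam s * ∑ g, d s g * ∏ i, Φ z (g i) + Φ z s * ∑ g ∈ R s, c s g *
          ((resMono P Q (Φ z)).1 ^ (κ s g).1 * (resMono P Q (Φ z)).2 ^ (κ s g).2) := by
      intro z
      simp only [hR, hs, if_true, Finset.sum_filter, Finset.mul_sum, ← Finset.sum_add_distrib]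
      refine Finset.sum_congr rfl fun g _ => ?_
      by_cases hg : lam s = mono lam (count g)
      · have : ∏ i, Φ z (g i) = Φ z s * ((resMono P Q (Φ z)).1 ^ (κ s g).1 *
            (resMono P Q (Φ z)).2 ^ (κ s g).2) := by
          rw [← mono_count, hκ2 s hs g hg, mono_add, mono_single, mono_comb]
          rfl
        rw [if_pos hg, this]
        simp only [hd, hs, if_true, if_pos hg]
        ring
      · rw [if_neg hg]
        simp only [hd, hs, if_true, if_neg hg]
        have : lam s - mono lam (count g) ≠ 0 := sub_ne_zero.2 hg
        field_simp
        ring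
    refine (((e1.add e2).add e3).sub e4).congr_left fun z => ?_
    have := key z
    simp only [hΦ', hq'] at this ⊢
    linear_combination -this
  · intro s hs
    refine (h.contract s hs).congr_left fun z => ?_
    simp [hΦ', hd, not_lt.2 hs]
  · intro s
    simp only [hq', add_sub_cancel_left]
    refine IsBigO.fun_sum fun g hg => IsBigO.const_mul_left (monomial_isBigO _ ?_) _
    -- A new resonant monomial has degree exactly `l`, whereas weight at most `k₀` would give degree
    -- below `l`.
    by_contra hlt
    have h1 := hk (κ s g) (by omega)
    have h2 := congrArg len (hκ2 s (hRmem s g hg).1 g (hRmem s g hg).2)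
    rw [len_count, len_add, len_single] at h2
    omega

/-! ### Arithmetic of the generators. -/

theorem linInd_nat {n : ℕ} {P Q : Fin n → ℕ}
    (h : LinearIndependent ℚ ![fun i => (P i : ℚ), fun i => (Q i : ℚ)])
    {s t : ℚ} (hst : ∀ i, s * P i + t * Q i = 0) : s = 0 ∧ t = 0 := by
  refine LinearIndependent.pair_iff.1 h s t ?_
  funext i
  simpa using hst i

theorem len_comb {n : ℕ} (P Q : Fin n → ℕ) (k : ℕ × ℕ) :
    len (comb P Q k) = k.1 * len P + k.2 * len Q := by
  simp [len, comb, Finset.sum_add_distrib, Finset.mul_sum]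

theorem len_pos {n : ℕ} {L : Fin n → ℕ} (h : L ≠ 0) : 1 ≤ len L := by
  obtain ⟨i, hi⟩ := Function.ne_iff.1 h
  exact (Nat.one_le_iff_ne_zero.2 hi).trans
    (Finset.single_le_sum (f := L) (fun _ _ => Nat.zero_le _) (Finset.mem_univ i))

theorem comb_swap {n : ℕ} (P Q : Fin n → ℕ) (k : ℕ × ℕ) : comb Q P k.swap = comb P Q k := by
  simp [comb, add_comm]

theorem AreGenerators.swap {n r : ℕ} {lam : Fin n → ℂ} {P Q : Fin n → ℕ}
    (h : AreGenerators lam r P Q) : AreGenerators lam r Q P := by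
  refine ⟨fun i hi => (h.1 i hi).symm, ?_, fun j hj L => (h.2.2 j hj L).trans ?_⟩
  · exact LinearIndependent.pair_symm_iff.1 h.2.1
  · constructor
    · rintro ⟨k, hk, rfl⟩
      exact ⟨k.swap, by simpa [add_comm] using hk, by rw [comb_swap]⟩
    · rintro ⟨k, hk, rfl⟩
      exact ⟨k.swap, by simpa [add_comm] using hk, by rw [comb_swap]⟩

theorem AreGenerators.left_ne_zero {n r : ℕ} {lam : Fin n → ℂ} {P Q : Fin n → ℕ}
    (h : AreGenerators lam r P Q) : P ≠ 0 := by
  rintro rfl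
  exact one_ne_zero (linInd_nat h.2.1 (s := 1) (t := 0) (by simp)).1

/-- The pair `(j, e_j + P)` is a resonance, so `λ_j = λ_j λ^P`. -/
theorem AreGenerators.mono_left {n r : ℕ} {lam : Fin n → ℂ} {P Q : Fin n → ℕ}
    (h : AreGenerators lam r P Q) {j : Fin n} (hj : j.val < r) (h0 : lam j ≠ 0) :
    mono lam P = 1 := by
  have h1 : comb P Q (1, 0) = P := by simp [comb]
  have := ((h.2.2 j hj (Pi.single j 1 + P)).2 ⟨(1, 0), by simp, by rw [h1]⟩).2
  rw [mono_add, mono_single] at this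
  exact (mul_left_cancel₀ h0 (by rw [mul_one, ← this])).symm

/-- If `P = e_i`, then `λ_i = λ^P = 1 = λ^(2Q)`, so `(i, 2Q)` is a resonance and `2Q = (1 + k₁) P +
k₂ Q`, against independence. Consequently the restriction `|k₁ P + k₂ Q| ≥ 2` in the normal form
discards no exponent of positive weight. -/
theorem AreGenerators.two_le_len_left {n r : ℕ} {lam : Fin n → ℂ} {P Q : Fin n → ℕ}
    (h : AreGenerators lam r P Q) {j : Fin n} (hj : j.val < r) (h0 : lam j ≠ 0) :
    2 ≤ len P := by
  by_contra hlt
  have hP1 : len P = 1 := le_antisymm (by omega) (len_pos h.left_ne_zero)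
  obtain ⟨i, hi⟩ := Function.ne_iff.1 h.left_ne_zero
  have hi' : P i ≠ 0 := hi
  have hPs : P = Pi.single i 1 := by
    have hs := Finset.add_sum_erase Finset.univ P (Finset.mem_univ i)
    change _ = len P at hs
    have hz : ∑ x ∈ Finset.univ.erase i, P x = 0 := by omega
    funext x
    by_cases hx : x = i
    · subst hx
      simp
      omega
    · simp [hx, Finset.sum_eq_zero_iff.1 hz x (by simp [hx])]
  have hir : i.val < r := by
    by_contra hc
    exact hi' (h.1 i (not_lt.1 hc)).1
  have hlami : lam i = 1 := by
    rw [← h.mono_left hj h0, hPs, mono_single]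
  have hQ := h.swap.mono_left hj h0
  obtain ⟨k, -, hk2⟩ := (h.2.2 i hir (2 • Q)).1 ⟨by
      have := len_pos h.swap.left_ne_zero
      have h2 : len (2 • Q) = 2 * len Q := by simp [len, Finset.mul_sum]
      omega, by rw [mono_smul, hQ, hlami, one_pow]⟩
  have := linInd_nat h.2.1 (s := 1 + k.1) (t := k.2 - 2) fun x => by
    have hx := congrFun hk2 x
    have hPx : P x = (Pi.single i 1 : Fin n → ℕ) x := by rw [← hPs]
    simp only [comb, Pi.add_apply, Pi.smul_apply, smul_eq_mul, ← hPx] at hx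
    have : (2 * Q x : ℚ) = P x + (k.1 * P x + k.2 * Q x) := by exact_mod_cast hx
    linarith
  have h3 : (1 + k.1 : ℚ) ≠ 0 := by positivity
  exact h3 this.1

theorem AreGenerators.two_le_len_comb {n r : ℕ} {lam : Fin n → ℂ} {P Q : Fin n → ℕ}
    (h : AreGenerators lam r P Q) {j : Fin n} (hj : j.val < r) (h0 : lam j ≠ 0)
    {k : ℕ × ℕ} (hk : 1 ≤ k.1 + k.2) : 2 ≤ len (comb P Q k) := by
  rw [len_comb]
  have h1 := h.two_le_len_left hj h0
  have h2 := h.swap.two_le_len_left hj h0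
  nlinarith

/-! ### Reduced coordinates of every order. -/

/-- The part of weight `k₀` of the resonant terms of the `s`-th coordinate. -/
def leadTerm {n : ℕ} (k₀ : ℕ) (a : ℕ × ℕ → Fin n → ℂ) (s : Fin n) (u : ℂ × ℂ) : ℂ :=
  ∑ k ∈ Finset.HasAntidiagonal.antidiagonal k₀, a k s * (u.1 ^ k.1 * u.2 ^ k.2)

/-- Start of the normalization, with `Φ = id`: terms of weight below `k₀` vanish by `ha`, those of
weight `k₀` are all present because `l` is large enough, and the others are `O(‖u‖^(k₀+1))`. -/
theorem exists_isReduced_of_normalForm {n r l k₀ : ℕ} {F : (Fin n → ℂ) → (Fin n → ℂ)}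
    {lam : Fin n → ℂ} {P Q : Fin n → ℕ} {a : ℕ × ℕ → Fin n → ℂ}
    (hN : IsNormalFormUpTo F lam r P Q a l) (hP : P ≠ 0) (hQ : Q ≠ 0) (hk₀ : 1 ≤ k₀)
    (h2 : ∀ k : ℕ × ℕ, 1 ≤ k.1 + k.2 → 2 ≤ len (comb P Q k))
    (hk : ∀ k : ℕ × ℕ, k.1 + k.2 ≤ k₀ → len (comb P Q k) + 1 < l)
    (ha : ∀ k : ℕ × ℕ, 1 ≤ k.1 + k.2 → k.1 + k.2 < k₀ → ∀ s : Fin n, s.val < r → a k s = 0) :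
    ∃ q, IsReduced F lam r P Q q id l ∧ ∀ s : Fin n, s.val < r →
      (fun u => q s u - leadTerm k₀ a s u) =O[𝓝 0] fun u => ‖u‖ ^ (k₀ + 1) := by
  have hpos : ∀ k ∈ exponents P Q l, 1 ≤ k.1 + k.2 := by
    intro k hk
    have := (Finset.mem_filter.1 hk).2.1
    by_contra hlt
    have h1 : k.1 = 0 := by omega
    have h2 : k.2 = 0 := by omega
    simp [len_comb, h1, h2] at this
  refine ⟨fun s u => ∑ k ∈ exponents P Q l, a k s * (u.1 ^ k.1 * u.2 ^ k.2),
    ⟨analyticAt_id, rfl, by simpa using! isBigO_zero (E' := Fin n → ℂ) (fun z : Fin n → ℂ => ‖z‖ ^ 2) (𝓝 0), fun s => ?_, fun s => ?_, fun s hs => ?_,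
      fun s hs => hN.2 s hs⟩, fun s hs => ?_⟩
  · exact Finset.analyticAt_fun_sum _ fun g _ => analyticAt_const.mul (analyticAt_monomial _ _)
  · refine Finset.sum_eq_zero fun k hk => ?_
    have := hpos k hk
    rcases Nat.eq_zero_or_pos k.1 with h0 | h0
    · have h2 : k.2 ≠ 0 := by omega
      simp [h2]
    · simp [h0.ne']
  · refine (hN.1 s hs).congr_left fun z => ?_
    simp only [mono_comb, id, resMono, mul_add, Finset.mul_sum]
    congr 2
    · ring
    · exact Finset.sum_congr rfl fun k _ => by ring
  · have hsub : Finset.HasAntidiagonal.antidiagonal k₀ ⊆ exponents P Q l := by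
      intro k hka
      have hka := Finset.HasAntidiagonal.mem_antidiagonal.1 hka
      have h3 := hk k hka.le
      refine Finset.mem_filter.2 ⟨?_, h2 k (by omega), h3⟩
      rw [len_comb] at h3
      have h4 := len_pos hP
      have h5 := len_pos hQ
      simp only [Finset.mem_product, Finset.mem_range]
      constructor <;> nlinarith
    simp only [leadTerm, ← Finset.sum_sdiff hsub, add_sub_cancel_right]
    refine IsBigO.fun_sum fun k hkm => ?_
    obtain ⟨h3, h4⟩ := Finset.mem_sdiff.1 hkm
    rw [Finset.HasAntidiagonal.mem_antidiagonal] at h4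
    rcases lt_or_gt_of_ne h4 with h5 | h5
    · simp only [ha k (hpos k h3) h5 s hs, zero_mul]
      exact isBigO_zero _ _
    · exact IsBigO.const_mul_left (monomial_isBigO k h5) _

theorem exists_isReduced {n r l₀ k₀ : ℕ} {F : (Fin n → ℂ) → (Fin n → ℂ)} {lam : Fin n → ℂ}
    {P Q : Fin n → ℕ} {a : ℕ × ℕ → Fin n → ℂ}
    (hF : AnalyticAt ℂ F 0) (hF0 : F 0 = 0)
    (hN : IsNormalFormUpTo F lam r P Q a l₀) (hP : P ≠ 0) (hQ : Q ≠ 0) (hk₀ : 1 ≤ k₀)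
    (h2 : ∀ k : ℕ × ℕ, 1 ≤ k.1 + k.2 → 2 ≤ len (comb P Q k))
    (hk : ∀ k : ℕ × ℕ, k.1 + k.2 ≤ k₀ → len (comb P Q k) + 1 < l₀)
    (ha : ∀ k : ℕ × ℕ, 1 ≤ k.1 + k.2 → k.1 + k.2 < k₀ → ∀ s : Fin n, s.val < r → a k s = 0)
    (hres : ∀ j : Fin n, j.val < r → ∀ L : Fin n → ℕ,
      IsResonance lam j L → ∃ k : ℕ × ℕ, 1 ≤ k.1 + k.2 ∧ L = Pi.single j 1 + comb P Q k)
    (m : ℕ) :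
    ∃ q Φ, IsReduced F lam r P Q q Φ (l₀ + m) ∧ ∀ s : Fin n, s.val < r →
      (fun u => q s u - leadTerm k₀ a s u) =O[𝓝 0] fun u => ‖u‖ ^ (k₀ + 1) := by
  induction m with
  | zero =>
    obtain ⟨q, h1, h3⟩ := exists_isReduced_of_normalForm hN hP hQ hk₀ h2 hk ha
    exact ⟨q, id, h1, h3⟩
  | succ m ih =>
    obtain ⟨q, Φ, h1, h3⟩ := ih
    have h4 : 2 ≤ l₀ := by have := hk (0, 0) (by simp); omega
    obtain ⟨q', Φ', h5, h6⟩ := h1.exists_succ hF hF0 hP hQ hres (by omega) (k₀ := k₀)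
      fun k hk' => (hk k hk').trans_le (by omega)
    exact ⟨q', Φ', h5, fun s hs => ((h6 s).add (h3 s hs)).congr_left fun u => by ring⟩

/-! ### From reduced coordinates to the shadow. -/

theorem mul_one_add_isBigO {E : Type*} [NormedAddCommGroup E] {k : ℕ} (hk : 1 ≤ k)
    {A B a b : E → ℂ} (hA : (fun u => A u - (1 + a u)) =O[𝓝 0] fun u => ‖u‖ ^ (k + 1))
    (ha : a =O[𝓝 0] fun u => ‖u‖ ^ k)
    (hB : (fun u => B u - (1 + b u)) =O[𝓝 0] fun u => ‖u‖ ^ (k + 1))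
    (hb : b =O[𝓝 0] fun u => ‖u‖ ^ k) :
    (fun u => A u * B u - (1 + (a u + b u))) =O[𝓝 0] fun u => ‖u‖ ^ (k + 1) := by
  have hone : (fun _ : E => (1 : ℂ)) =O[𝓝 0] fun u : E => ‖u‖ ^ 0 := by
    simpa using! isBigO_refl (fun _ : E => (1 : ℂ)) (𝓝 0)
  have h1 : ∀ {c : E → ℂ}, c =O[𝓝 0] (fun u => ‖u‖ ^ k) →
      (fun u => 1 + c u) =O[𝓝 0] fun u : E => ‖u‖ ^ 0 := fun hc =>
    hone.add (hc.trans (isBigO_pow_of_le (E := E) (Nat.zero_le k)))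
  have hB1 : B =O[𝓝 0] fun u : E => ‖u‖ ^ 0 :=
    ((hB.trans (isBigO_pow_of_le (E := E) (Nat.zero_le _))).add (h1 hb)).congr_left fun u => by ring
  have e1 := (hA.mul hB1).congr_right (g₂ := fun u => ‖u‖ ^ (k + 1)) fun u => by ring
  have e2 := ((h1 ha).mul hB).congr_right (g₂ := fun u => ‖u‖ ^ (k + 1)) fun u => by ring
  have e3 := ((ha.mul hb).congr_right (g₂ := fun u => ‖u‖ ^ (k + k)) fun u => by ring).trans
    (isBigO_pow_of_le (E := E) (show k + 1 ≤ k + k by omega))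
  exact ((e1.add e2).add e3).congr_left fun u => by ring

theorem pow_one_add_isBigO {E : Type*} [NormedAddCommGroup E] {k : ℕ} (hk : 1 ≤ k)
    {A a : E → ℂ} (hA : (fun u => A u - (1 + a u)) =O[𝓝 0] fun u => ‖u‖ ^ (k + 1))
    (ha : a =O[𝓝 0] fun u => ‖u‖ ^ k) (m : ℕ) :
    (fun u => A u ^ m - (1 + m * a u)) =O[𝓝 0] fun u => ‖u‖ ^ (k + 1) := by
  induction m with
  | zero => simpa using isBigO_zero _ _
  | succ m ih =>
    refine (mul_one_add_isBigO hk ih (ha.const_mul_left _) hA ha).congr_left fun u => ?_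
    push_cast
    ring

theorem prod_one_add_isBigO {E ι : Type*} [NormedAddCommGroup E] {k : ℕ} (hk : 1 ≤ k)
    {A a : ι → E → ℂ} (p : ι → ℕ) (s : Finset ι)
    (hA : ∀ j, p j ≠ 0 → (fun u => A j u - (1 + a j u)) =O[𝓝 0] fun u => ‖u‖ ^ (k + 1))
    (ha : ∀ j, a j =O[𝓝 0] fun u => ‖u‖ ^ k) :
    (fun u => ∏ j ∈ s, A j u ^ p j - (1 + ∑ j ∈ s, p j * a j u))
      =O[𝓝 0] fun u => ‖u‖ ^ (k + 1) := by
  classical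
  induction s using Finset.induction_on with
  | empty => simpa using isBigO_zero _ _
  | insert i s hi ih =>
    simp only [Finset.prod_insert hi, Finset.sum_insert hi]
    refine mul_one_add_isBigO hk ?_ ((ha i).const_mul_left _) ih
      (IsBigO.fun_sum fun j _ => (ha j).const_mul_left _)
    by_cases hpi : p i = 0
    · simpa [hpi] using isBigO_zero _ _
    · exact pow_one_add_isBigO hk (hA i hpi) (ha i) _

/-- The homogeneous map of `ℂ²` induced on `(z ^ P, z ^ Q)` by the terms `fib j` of the
coordinates. -/
def shadowMap {n : ℕ} (P Q : Fin n → ℕ) (fib : Fin n → ℂ × ℂ → ℂ) (u : ℂ × ℂ) : ℂ × ℂ :=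
  (u.1 * ∑ j, P j * fib j u, u.2 * ∑ j, Q j * fib j u)

/-- Coordinates `Φ` in which the pair of resonant monomials evolves according to `shadowMap`,
up to terms of higher order. -/
structure IsShadowed {n : ℕ} (F : (Fin n → ℂ) → (Fin n → ℂ)) (lam : Fin n → ℂ) (r : ℕ)
    (P Q : Fin n → ℕ) (fib : Fin n → ℂ × ℂ → ℂ) (k l : ℕ)
    (Φ : (Fin n → ℂ) → (Fin n → ℂ)) : Prop where
  map_zero : Φ 0 = 0
  continuous : ∀ᶠ z in 𝓝 0, ContinuousAt Φ z
  le_map : 𝓝 0 ≤ map Φ (𝓝 0)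
  bound : (fun z => z) =O[𝓝 0] Φ
  base : (fun z => resMono P Q (Φ (F z)) - (resMono P Q (Φ z) +
    shadowMap P Q fib (resMono P Q (Φ z)))) =O[𝓝 0]
      fun z => ‖resMono P Q (Φ z)‖ ^ (k + 2) + ‖Φ z‖ ^ l
  fiber : ∀ j : Fin n, j.val < r →
    (fun z => Φ (F z) j - lam j * (Φ z j * (1 + fib j (resMono P Q (Φ z))))) =O[𝓝 0]
      fun z => ‖Φ z‖ * ‖resMono P Q (Φ z)‖ ^ (k + 1) + ‖Φ z‖ ^ l
  contract : ∀ j : Fin n, r ≤ j.val →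
    (fun z => Φ (F z) j - lam j * Φ z j) =O[𝓝 0] fun z => ‖Φ z‖ ^ 2

/-- All the estimates are expressed through `Φ z` and `Φ (F z)`, so they pull back along the
conjugacy `ψ`; the germ inverse of `ψ` supplies the two conditions `le_map` and `bound`. -/
theorem IsShadowed.comp {n r k l : ℕ} {F Ft ψ Φ : (Fin n → ℂ) → (Fin n → ℂ)} {lam : Fin n → ℂ}
    {P Q : Fin n → ℕ} {fib : Fin n → ℂ × ℂ → ℂ} (h : IsShadowed Ft lam r P Q fib k l Φ)
    (hψ : IsGermBiholo ψ) (hc : ∀ᶠ z in 𝓝 0, ψ (F z) = Ft (ψ z)) :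
    IsShadowed F lam r P Q fib k l (fun z => Φ (ψ z)) := by
  obtain ⟨hψ0, hψa, G, hG0, hGa, hGψ, hψG⟩ := hψ
  have ht : Tendsto ψ (𝓝 0) (𝓝 0) := by simpa [ContinuousAt, hψ0] using hψa.continuousAt
  have htG : Tendsto G (𝓝 0) (𝓝 0) := by simpa [ContinuousAt, hG0] using hGa.continuousAt
  refine ⟨by rw [hψ0, h.map_zero], ?_, ?_, ?_, ?_, fun j hj => ?_, fun j hj => ?_⟩
  · filter_upwards [ht.eventually h.continuous, hψa.eventually_analyticAt] with z h1 h2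
    exact h1.comp h2.continuousAt
  · have h1 : 𝓝 0 ≤ map ψ (𝓝 0) := by
      have : map (fun z => ψ (G z)) (𝓝 0) = 𝓝 0 := by
        rw [map_congr hψG]; exact map_id
      calc 𝓝 0 = map ψ (map G (𝓝 0)) := by rw [map_map]; exact this.symm
        _ ≤ map ψ (𝓝 0) := map_mono htG
    calc 𝓝 0 ≤ map Φ (𝓝 0) := h.le_map
      _ ≤ map Φ (map ψ (𝓝 0)) := map_mono h1
  · have h1 : (fun z => G (ψ z)) =O[𝓝 0] fun z => ψ z := by
      have := (isBigO_norm_right.1 (isBigO_norm_of_analyticAt hGa hG0)).comp_tendsto ht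
      exact this
    refine (h1.congr' hGψ EventuallyEq.rfl).trans ?_
    exact h.bound.comp_tendsto ht
  · refine (h.base.comp_tendsto ht).congr' ?_ EventuallyEq.rfl
    filter_upwards [hc] with z hz
    simp [hz]
  · refine ((h.fiber j hj).comp_tendsto ht).congr' ?_ EventuallyEq.rfl
    filter_upwards [hc] with z hz
    simp [hz]
  · refine ((h.contract j hj).comp_tendsto ht).congr' ?_ EventuallyEq.rfl
    filter_upwards [hc] with z hz
    simp [hz]

theorem isBigO_of_tangent {E : Type*} [NormedAddCommGroup E] {Φ : E → E}
    (h : (fun z => Φ z - z) =O[𝓝 0] fun z => ‖z‖ ^ 2) : (fun z => z) =O[𝓝 0] Φ := by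
  obtain ⟨C, hC⟩ := h.bound
  refine IsBigO.of_bound 2 ?_
  have h1 : ∀ᶠ z : E in 𝓝 0, C * ‖z‖ < 1 / 2 := by
    have : Tendsto (fun z : E => C * ‖z‖) (𝓝 0) (𝓝 (C * ‖(0 : E)‖)) := by
      exact (continuous_const.mul continuous_norm).tendsto 0
    exact this.eventually_lt_const (by simp)
  filter_upwards [hC, h1] with z hz hz'
  rw [norm_pow, norm_norm] at hz
  have h2 : ‖z‖ ≤ ‖Φ z‖ + ‖Φ z - z‖ := by
    simpa using norm_sub_le (Φ z) (Φ z - z)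
  nlinarith [norm_nonneg z]

theorem nhds_le_map_of_tangent {n : ℕ} {Φ : (Fin n → ℂ) → (Fin n → ℂ)} (ha : AnalyticAt ℂ Φ 0)
    (h0 : Φ 0 = 0) (h : (fun z => Φ z - z) =O[𝓝 0] fun z => ‖z‖ ^ 2) :
    𝓝 0 ≤ map Φ (𝓝 0) := by
  have h1 : HasFDerivAt Φ (ContinuousLinearMap.id ℂ (Fin n → ℂ)) 0 := by
    rw [hasFDerivAt_iff_isLittleO_nhds_zero]
    have h2 : (fun z : Fin n → ℂ => ‖z‖ ^ 2) =o[𝓝 0] fun z => z :=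
      (isLittleO_norm_pow_id one_lt_two)
    simpa [h0] using! h.trans_isLittleO h2
  have h3 := ha.hasStrictFDerivAt
  rw [h1.fderiv] at h3
  have h4 : HasStrictFDerivAt Φ
    ((ContinuousLinearEquiv.refl ℂ (Fin n → ℂ) : (Fin n → ℂ) ≃L[ℂ] (Fin n → ℂ)) :
      (Fin n → ℂ) →L[ℂ] (Fin n → ℂ)) 0 := h3
  have := h4.map_nhds_eq_of_equiv
  rw [h0] at this
  exact this.ge

/-- The multiplicative form of the normalized coordinates turns a monomial `Φ^L` into `λ^L Φ^L ∏ (1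
+ q_j / λ_j)^(L_j)`; as `λ^L = 1`, only the parabolic factor remains, and its leading part is `1 + ∑
L_j f_j`. -/
theorem IsReduced.base_isBigO {n r l k : ℕ} {F Φ : (Fin n → ℂ) → (Fin n → ℂ)} {lam : Fin n → ℂ}
    {P Q L : Fin n → ℕ} {q fib : Fin n → ℂ × ℂ → ℂ} (h : IsReduced F lam r P Q q Φ l)
    (hF : AnalyticAt ℂ F 0) (hF0 : F 0 = 0) (hP : P ≠ 0) (hQ : Q ≠ 0) (hk : 1 ≤ k)
    (hfib : ∀ j, fib j =O[𝓝 0] fun u => ‖u‖ ^ k)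
    (hq : ∀ j : Fin n, j.val < r → (fun u => q j u - lam j * fib j u)
      =O[𝓝 0] fun u => ‖u‖ ^ (k + 1))
    (hlam : ∀ j : Fin n, j.val < r → lam j ≠ 0) (hL : ∀ j : Fin n, r ≤ j.val → L j = 0)
    (hL1 : mono lam L = 1) :
    (fun z => mono (Φ (F z)) L - mono (Φ z) L *
      (1 + ∑ j, L j * fib j (resMono P Q (Φ z)))) =O[𝓝 0]
      fun z => ‖mono (Φ z) L‖ * ‖resMono P Q (Φ z)‖ ^ (k + 1) + ‖z‖ ^ l := by
  have hΦt : Tendsto Φ (𝓝 0) (𝓝 0) := by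
    simpa [ContinuousAt, h.map_zero] using h.analytic.continuousAt
  have hFt : Tendsto F (𝓝 0) (𝓝 0) := by simpa [ContinuousAt, hF0] using hF.continuousAt
  have hUt : Tendsto (fun z => resMono P Q (Φ z)) (𝓝 0) (𝓝 0) := by
    have := (analyticAt_resMono P Q 0).continuousAt
    rw [ContinuousAt, resMono_zero hP hQ] at this
    exact this.comp hΦt
  -- The truncated map. Its entries beyond `r` do not enter the monomial, so taking them equal to
  -- those of `Φ (F z)` makes their error zero.
  set A : (Fin n → ℂ) → Fin n → ℂ := fun z j =>
    if j.val < r then Φ z j * (lam j + q j (resMono P Q (Φ z))) else Φ (F z) j with hA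
  have hAd : (fun z => Φ (F z) - A z) =O[𝓝 0] fun z => ‖z‖ ^ l := by
    rw [isBigO_pi]
    intro j
    by_cases hj : j.val < r
    · simpa [hA, hj] using h.normal j hj
    · simpa [hA, hj] using isBigO_zero _ _
  have hAt : Tendsto A (𝓝 0) (𝓝 0) := by
    rw [tendsto_pi_nhds]
    intro j
    by_cases hj : j.val < r
    · simp only [hA, hj, if_true]
      have h1 := (h.analytic_res j).continuousAt.tendsto.comp hUt
      have h2 := ((tendsto_pi_nhds.1 hΦt j).mul (h1.const_add (lam j)))
      simpa using! h2
    · simp only [hA, hj, if_false]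
      exact tendsto_pi_nhds.1 (hΦt.comp hFt) j
  have e1 : (fun z => mono (Φ (F z)) L - mono (A z) L) =O[𝓝 0] fun z => ‖z‖ ^ l := by
    have hst := (analyticAt_mono L (0 : Fin n → ℂ)).hasStrictFDerivAt.isBigO_sub
    have ht : Tendsto (fun z => (Φ (F z), A z)) (𝓝 0)
        (𝓝 ((0 : Fin n → ℂ), (0 : Fin n → ℂ))) := (hΦt.comp hFt).prodMk_nhds hAt
    exact (hst.comp_tendsto ht).trans hAd
  have e2 := (prod_one_add_isBigO hk (A := fun j u => 1 + q j u / lam j) L Finset.univ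
    (fun j hj => by
      have hjr : j.val < r := by
        by_contra hc
        exact hj (hL j (not_lt.1 hc))
      refine ((hq j hjr).const_mul_left (lam j)⁻¹).congr_left fun u => ?_
      have := hlam j hjr
      field_simp
      ring) hfib).comp_tendsto hUt
  have hprod : ∀ z, mono (A z) L = mono (Φ z) L *
      ∏ j, (1 + q j (resMono P Q (Φ z)) / lam j) ^ L j := by
    intro z
    have hx : mono (A z) L = mono lam L * (mono (Φ z) L *
        ∏ j, (1 + q j (resMono P Q (Φ z)) / lam j) ^ L j) := by
      simp only [mono, ← Finset.prod_mul_distrib]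
      refine Finset.prod_congr rfl fun j _ => ?_
      by_cases hj : j.val < r
      · have := hlam j hj
        simp only [hA, hj, if_true, ← mul_pow]
        congr 1
        field_simp
      · simp [hL j (not_lt.1 hj)]
    rw [hx, hL1, one_mul]
  have e3 : (fun z => mono (A z) L - mono (Φ z) L *
      (1 + ∑ j, L j * fib j (resMono P Q (Φ z)))) =O[𝓝 0]
      fun z => ‖mono (Φ z) L‖ * ‖resMono P Q (Φ z)‖ ^ (k + 1) := by
    have := (isBigO_norm_right.2 (isBigO_refl (fun z => mono (Φ z) L) (𝓝 0))).mul e2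
    refine this.congr_left fun z => ?_
    simp only [hprod, Function.comp]
    ring
  have e4 := e1.trans (IsBigO.of_bound 1 (g := fun z => ‖mono (Φ z) L‖ *
    ‖resMono P Q (Φ z)‖ ^ (k + 1) + ‖z‖ ^ l) (Eventually.of_forall fun z => by
      rw [Real.norm_of_nonneg (by positivity), Real.norm_of_nonneg (by positivity)]
      simp only [one_mul, le_add_iff_nonneg_left]
      positivity))
  have e5 := e3.trans (IsBigO.of_bound 1 (g := fun z => ‖mono (Φ z) L‖ *
    ‖resMono P Q (Φ z)‖ ^ (k + 1) + ‖z‖ ^ l) (Eventually.of_forall fun z => by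
      rw [Real.norm_of_nonneg (by positivity), Real.norm_of_nonneg (by positivity)]
      simp only [one_mul, le_add_iff_nonneg_right]
      positivity))
  exact (e4.add e5).congr_left fun z => by ring

theorem isBigO_of_le_of_nonneg {E G : Type*} [TopologicalSpace E] [Zero E] [NormedAddCommGroup G]
    {f : E → G} {g g' : E → ℝ} (h : f =O[𝓝 0] g) (h0 : ∀ z, 0 ≤ g z) (hg : ∀ z, g z ≤ g' z) :
    f =O[𝓝 0] g' :=
  h.trans (IsBigO.of_bound 1 (Eventually.of_forall fun z => by
    rw [Real.norm_of_nonneg (h0 z), Real.norm_of_nonneg ((h0 z).trans (hg z)), one_mul]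
    exact hg z))

theorem IsReduced.isShadowed {n r l k : ℕ} {F Φ : (Fin n → ℂ) → (Fin n → ℂ)} {lam : Fin n → ℂ}
    {P Q : Fin n → ℕ} {q fib : Fin n → ℂ × ℂ → ℂ} (h : IsReduced F lam r P Q q Φ l)
    (hF : AnalyticAt ℂ F 0) (hF0 : F 0 = 0) (hP : P ≠ 0) (hQ : Q ≠ 0) (hk : 1 ≤ k)
    (hfib : ∀ j, fib j =O[𝓝 0] fun u => ‖u‖ ^ k)
    (hq : ∀ j : Fin n, j.val < r → (fun u => q j u - lam j * fib j u)
      =O[𝓝 0] fun u => ‖u‖ ^ (k + 1))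
    (hlam : ∀ j : Fin n, j.val < r → lam j ≠ 0)
    (hs : ∀ j : Fin n, r ≤ j.val → P j = 0 ∧ Q j = 0)
    (hP1 : mono lam P = 1) (hQ1 : mono lam Q = 1) :
    IsShadowed F lam r P Q fib k l Φ := by
  have hz : (fun z : Fin n → ℂ => z) =O[𝓝 0] Φ := isBigO_of_tangent h.tangent
  have hzp : ∀ m : ℕ, (fun z : Fin n → ℂ => ‖z‖ ^ m) =O[𝓝 0] fun z => ‖Φ z‖ ^ m := fun m =>
    (hz.norm_left.norm_right).pow m
  have hΦt : Tendsto Φ (𝓝 0) (𝓝 0) := by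
    simpa [ContinuousAt, h.map_zero] using h.analytic.continuousAt
  have hUt : Tendsto (fun z => resMono P Q (Φ z)) (𝓝 0) (𝓝 0) := by
    have := (analyticAt_resMono P Q 0).continuousAt
    rw [ContinuousAt, resMono_zero hP hQ] at this
    exact this.comp hΦt
  have hmon : ∀ L : Fin n → ℕ, (∀ j : Fin n, r ≤ j.val → L j = 0) → mono lam L = 1 →
      (∀ z, ‖mono (Φ z) L‖ ≤ ‖resMono P Q (Φ z)‖) →
      (fun z => mono (Φ (F z)) L - mono (Φ z) L *
      (1 + ∑ j, L j * fib j (resMono P Q (Φ z)))) =O[𝓝 0]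
      fun z => ‖resMono P Q (Φ z)‖ ^ (k + 2) + ‖Φ z‖ ^ l := by
    intro L hL hL1 hle
    have e := h.base_isBigO hF hF0 hP hQ hk hfib hq hlam hL hL1
    have e1 : (fun z => ‖mono (Φ z) L‖ * ‖resMono P Q (Φ z)‖ ^ (k + 1)) =O[𝓝 0]
        fun z => ‖resMono P Q (Φ z)‖ ^ (k + 2) + ‖Φ z‖ ^ l := by
      refine IsBigO.of_bound 1 (Eventually.of_forall fun z => ?_)
      rw [Real.norm_of_nonneg (by positivity), Real.norm_of_nonneg (by positivity), one_mul,
        pow_succ _ (k + 1), mul_comm]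
      have := mul_le_mul_of_nonneg_left (hle z)
        (by positivity : 0 ≤ ‖resMono P Q (Φ z)‖ ^ (k + 1))
      have h2 : 0 ≤ ‖Φ z‖ ^ l := by positivity
      linarith
    have e2 := isBigO_of_le_of_nonneg (hzp l)
      (g' := fun z => ‖resMono P Q (Φ z)‖ ^ (k + 2) + ‖Φ z‖ ^ l) (fun z => by positivity)
      (fun z => le_add_of_nonneg_left (by positivity))
    exact e.trans (e1.add e2)
  refine ⟨h.map_zero, ?_, nhds_le_map_of_tangent h.analytic h.map_zero h.tangent, hz, ?_,
    fun j hj => ?_, fun j hj => ?_⟩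
  · filter_upwards [h.analytic.eventually_analyticAt] with z hz using hz.continuousAt
  · have e1 := hmon P (fun j hj => (hs j hj).1) hP1 fun z => norm_fst_le (resMono P Q (Φ z))
    have e2 := hmon Q (fun j hj => (hs j hj).2) hQ1 fun z => norm_snd_le (resMono P Q (Φ z))
    refine (e1.prod_left e2).congr_left fun z => ?_
    simp only [resMono, shadowMap, Prod.mk_add_mk, Prod.mk_sub_mk]
    congr 1 <;> ring
  · have e1 := (h.normal j hj).trans (hzp l)
    have e3 := (isBigO_apply (isBigO_norm_right.2 (isBigO_refl Φ (𝓝 0))) j).mul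
      ((hq j hj).comp_tendsto hUt)
    simp only [Function.comp] at e3
    have e4 := isBigO_of_le_of_nonneg e1
      (g' := fun z => ‖Φ z‖ * ‖resMono P Q (Φ z)‖ ^ (k + 1) + ‖Φ z‖ ^ l) (fun z => by positivity)
      (fun z => le_add_of_nonneg_left (by positivity))
    have e5 := isBigO_of_le_of_nonneg e3
      (g' := fun z => ‖Φ z‖ * ‖resMono P Q (Φ z)‖ ^ (k + 1) + ‖Φ z‖ ^ l) (fun z => by positivity)
      (fun z => le_add_of_nonneg_right (by positivity))
    exact (e4.add e5).congr_left fun z => by ring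
  · exact (h.contract j hj).trans (hzp 2)

theorem fiberTerm_isBigO {n : ℕ} (lam : Fin n → ℂ) (k₀ : ℕ) (a : ℕ × ℕ → Fin n → ℂ) (j : Fin n) :
    fiberTerm lam k₀ a j =O[𝓝 0] fun u => ‖u‖ ^ k₀ := by
  refine IsBigO.fun_sum fun k hk => ?_
  rw [Finset.HasAntidiagonal.mem_antidiagonal] at hk
  refine ((monomial_isBigO k hk.ge).const_mul_left (a k j / lam j)).congr_left fun u => ?_
  ring

theorem leadTerm_eq {n : ℕ} {lam : Fin n → ℂ} (k₀ : ℕ) (a : ℕ × ℕ → Fin n → ℂ) {j : Fin n}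
    (h : lam j ≠ 0) (u : ℂ × ℂ) : leadTerm k₀ a j u = lam j * fiberTerm lam k₀ a j u := by
  rw [leadTerm, fiberTerm, Finset.mul_sum]
  refine Finset.sum_congr rfl fun k _ => ?_
  field_simp

theorem exists_isShadowed {n r k₀ : ℕ} {F : (Fin n → ℂ) → (Fin n → ℂ)}
    {lam : Fin n → ℂ} {P Q : Fin n → ℕ} {a : ℕ × ℕ → Fin n → ℂ} (hr : 1 ≤ r) (hrn : r ≤ n)
    (hPQ : AreGenerators lam r P Q) (hlam : ∀ j : Fin n, j.val < r → lam j ≠ 0)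
    (ha : IsShadowData F lam r P Q k₀ a) (l : ℕ) :
    ∃ l' Φ, l ≤ l' ∧ IsShadowed F lam r P Q (fiberTerm lam k₀ a) k₀ l' Φ := by
  obtain ⟨hk₀, ⟨l₀, ψ, Ft, hl₀, hψ, hFt, hconj, hN⟩, ha0, -⟩ := ha
  have hj0 : (⟨0, by omega⟩ : Fin n).val < r := by simp; omega
  have hP := hPQ.left_ne_zero
  have hQ := hPQ.swap.left_ne_zero
  obtain ⟨q, Φ, h1, h2⟩ := exists_isReduced hFt.2.1 hFt.1 hN hP hQ hk₀
    (fun k hk => hPQ.two_le_len_comb hj0 (hlam _ hj0) hk) hl₀ ha0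
    (fun j hj L hL => (hPQ.2.2 j hj L).1 hL) l
  refine ⟨l₀ + l, _, by omega, (h1.isShadowed hFt.2.1 hFt.1 hP hQ hk₀ (fiberTerm_isBigO lam k₀ a)
    (fun j hj => ?_) hlam hPQ.1 (hPQ.mono_left hj0 (hlam _ hj0))
    (hPQ.swap.mono_left hj0 (hlam _ hj0))).comp hψ hconj⟩
  simpa only [leadTerm_eq k₀ a (hlam j hj)] using h2 j hj

/-! ### The petal of the blown-up model. -/

theorem inv_one_add_pow_approx (k : ℕ) {η : ℝ} (hη : 0 < η) :
    ∃ δ > 0, ∀ ζ : ℂ, ‖ζ‖ ≤ δ → ‖((1 + ζ) ^ k)⁻¹ - 1 + k * ζ‖ ≤ η * ‖ζ‖ := by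
  have h1 : HasDerivAt (fun ζ : ℂ => ((1 + ζ) ^ k)⁻¹) (-k) 0 := by
    have := (((hasDerivAt_id (0 : ℂ)).const_add 1).fun_pow k).fun_inv (by simp)
    simpa using! this
  have h2 := (hasDerivAt_iff_isLittleO_nhds_zero.1 h1).bound hη
  obtain ⟨δ, hδ, h3⟩ := Metric.eventually_nhds_iff.1 h2
  refine ⟨δ / 2, half_pos hδ, fun ζ hζ => ?_⟩
  have := h3 (y := ζ) (by rw [dist_zero_right]; linarith)
  simpa [mul_comm] using this

theorem norm_le_of_sector {τ : ℂ} {κ : ℝ} (h : |τ.im| ≤ κ * τ.re) (h0 : 0 ≤ τ.re) :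
    ‖τ‖ ≤ (1 + κ) * τ.re := by
  have := Complex.norm_le_abs_re_add_abs_im τ
  rw [abs_of_nonneg h0] at this
  linarith

/-- For `τ` almost real and positive, `Re (τ f')` is close to `|τ| Re f`, and this negative term
dominates the quadratic one in `|1 + τ f'|²`. A single `δ` serves as size, sector aperture,
tolerance and contraction rate. -/
theorem contraction_eventually {f : ℂ} (hf : f.re < 0) : ∀ᶠ δ in 𝓝[>] (0 : ℝ), ∀ τ f' : ℂ,
    ‖τ‖ ≤ δ → |τ.im| ≤ δ * τ.re → ‖f' - f‖ ≤ δ → ‖1 + τ * f'‖ ≤ 1 - δ * ‖τ‖ := by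
  set B := ‖f‖ + 1 with hB
  have hB1 : 1 ≤ B := by simp [hB]
  -- The three summands pay for `2 Re (τ f')`, for `|τ f'|²`, and for the gain `2 δ |τ|` to be kept.
  have ht : Tendsto (fun δ : ℝ => δ * (2 * (B + 1) + B ^ 2 + 2)) (𝓝[>] 0) (𝓝 0) := by
    have : Tendsto (fun δ : ℝ => δ * (2 * (B + 1) + B ^ 2 + 2)) (𝓝 0)
      (𝓝 (0 * (2 * (B + 1) + B ^ 2 + 2))) := (continuous_id.mul continuous_const).tendsto 0
    rw [zero_mul] at this
    exact this.mono_left nhdsWithin_le_nhds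
  filter_upwards [self_mem_nhdsWithin, ht.eventually_lt_const (neg_pos.2 hf),
    (eventually_lt_nhds (show (0 : ℝ) < 1 by norm_num)).filter_mono nhdsWithin_le_nhds]
    with δ hδ0 hδ hδ1 τ f' hτ him hff
  have hδ0 : 0 < δ := hδ0
  have hre : 0 ≤ τ.re := by
    by_contra hc
    have := mul_neg_of_pos_of_neg hδ0 (not_le.1 hc)
    linarith [abs_nonneg τ.im]
  have h1 : ‖τ‖ ≤ 2 * τ.re := by
    have := norm_le_of_sector him hre
    nlinarith
  have hret : τ.re ≤ ‖τ‖ := (le_abs_self _).trans (Complex.abs_re_le_norm τ)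
  have him2 : |τ.im| ≤ δ * ‖τ‖ := him.trans (mul_le_mul_of_nonneg_left hret hδ0.le)
  have hf' : ‖f'‖ ≤ B := by
    have : ‖f'‖ ≤ ‖f‖ + ‖f' - f‖ := by simpa using norm_add_le f (f' - f)
    linarith
  have hre2 : (τ * f').re ≤ ‖τ‖ * (f.re / 2 + B * δ + δ) := by
    have e1 : (τ * f').re = τ.re * f.re - τ.im * f.im + (τ * (f' - f)).re := by
      simp [mul_sub]
    have e2 : (τ * (f' - f)).re ≤ ‖τ‖ * δ := by
      refine ((le_abs_self _).trans (Complex.abs_re_le_norm _)).trans ?_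
      rw [norm_mul]
      gcongr
    have e3 : -(τ.im * f.im) ≤ δ * ‖τ‖ * B := by
      refine (neg_le_abs _).trans ?_
      rw [abs_mul]
      have : |f.im| ≤ B := (Complex.abs_im_le_norm f).trans (by linarith)
      gcongr
    have e4 : τ.re * f.re ≤ ‖τ‖ * (f.re / 2) := by nlinarith
    rw [e1]
    nlinarith
  have hsq : ‖1 + τ * f'‖ ^ 2 = 1 + 2 * (τ * f').re + ‖τ * f'‖ ^ 2 := by
    rw [Complex.sq_norm, Complex.sq_norm, Complex.normSq_apply, Complex.normSq_apply]
    simp only [Complex.add_re, Complex.one_re, Complex.add_im, Complex.one_im]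
    ring
  have hτn := norm_nonneg τ
  have h3 : ‖τ * f'‖ ^ 2 ≤ ‖τ‖ * (δ * B ^ 2) := by
    rw [norm_mul, mul_pow]
    have : ‖τ‖ ^ 2 ≤ ‖τ‖ * δ := by nlinarith
    have h4 : ‖f'‖ ^ 2 ≤ B ^ 2 := by gcongr
    calc ‖τ‖ ^ 2 * ‖f'‖ ^ 2 ≤ (‖τ‖ * δ) * B ^ 2 := by gcongr
      _ = _ := by ring
  have h5 : 0 ≤ 1 - δ * ‖τ‖ := by nlinarith
  refine abs_le_of_sq_le_sq' ?_ h5 |>.2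
  rw [hsq]
  have h6 : ‖τ‖ * (δ * (2 * (B + 1) + B ^ 2 + 2)) ≤ ‖τ‖ * (-f.re) :=
    mul_le_mul_of_nonneg_left hδ.le hτn
  nlinarith [sq_nonneg (δ * ‖τ‖)]

/-- The attracting domain of the model `x ↦ x - x ^ (k + 1) / k`, `y ↦ y + C x ^ k y ^ (σ + 1)`. -/
def petal (k σ : ℕ) (C : ℂ) (κ ε : ℝ) : Set (ℂ × ℂ) :=
  {p | ε⁻¹ < ((p.1 ^ k)⁻¹).re ∧ |((p.1 ^ k)⁻¹).im| < κ * ((p.1 ^ k)⁻¹).re ∧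
    ε⁻¹ < (-(σ * C * p.2 ^ σ)⁻¹).re ∧ ‖p.1‖ < ε * ‖p.2‖ ^ (σ + 1)}

theorem petal_snd_ne_zero {k σ : ℕ} {C : ℂ} {κ ε : ℝ} {p : ℂ × ℂ} (h : p ∈ petal k σ C κ ε) :
    p.2 ≠ 0 := by
  intro h0
  have := h.2.2.2
  simp [h0] at this
  exact absurd this (norm_nonneg p.1).not_gt

theorem petal_fst_ne_zero {k σ : ℕ} {C : ℂ} {κ ε : ℝ} {p : ℂ × ℂ} (hε : 0 < ε) (hk : k ≠ 0)
    (h : p ∈ petal k σ C κ ε) : p.1 ≠ 0 := by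
  intro h0
  have := h.1
  simp [h0, hk] at this
  linarith

theorem petal_small {k σ : ℕ} (hk : k ≠ 0) (hσ : σ ≠ 0) {C : ℂ} (hC : C ≠ 0) (κ : ℝ)
    {ρ : ℝ} (hρ : 0 < ρ) : ∀ᶠ ε in 𝓝[>] (0 : ℝ), ∀ p ∈ petal k σ C κ ε,
      p.1 ≠ 0 ∧ p.2 ≠ 0 ∧ ‖p.1‖ ≤ ρ ∧ ‖p.2‖ ≤ ρ ∧ ‖p.1‖ ≤ ρ * ‖p.2‖ ^ (σ + 1) ∧
      ‖p.1 ^ k‖ ≤ ρ ∧ |(p.1 ^ k).im| ≤ κ * (p.1 ^ k).re ∧ 0 < (p.1 ^ k).re := by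
  have hσC : 0 < ‖(σ : ℂ) * C‖ := norm_pos_iff.2 (mul_ne_zero (by exact_mod_cast hσ) hC)
  filter_upwards [self_mem_nhdsWithin,
    (eventually_lt_nhds hρ).filter_mono nhdsWithin_le_nhds,
    (eventually_lt_nhds (pow_pos hρ k)).filter_mono nhdsWithin_le_nhds,
    (eventually_lt_nhds (mul_pos hσC (pow_pos hρ σ))).filter_mono nhdsWithin_le_nhds]
    with ε hε0 hε1 hε2 hε3 p hp
  have hε0 : 0 < ε := hε0
  have hx := petal_fst_ne_zero hε0 hk hp
  have hy := petal_snd_ne_zero hp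
  obtain ⟨h1, h2, h3, h4⟩ := hp
  have hτ : ‖p.1 ^ k‖ < ε := by
    have : ε⁻¹ < ‖(p.1 ^ k)⁻¹‖ := h1.trans_le ((le_abs_self _).trans (Complex.abs_re_le_norm _))
    rw [norm_inv] at this
    exact (inv_lt_inv₀ hε0 (norm_pos_iff.2 (pow_ne_zero k hx))).1 this
  have hyσ : ‖(σ : ℂ) * C‖ * ‖p.2‖ ^ σ < ε := by
    have : ε⁻¹ < ‖-(σ * C * p.2 ^ σ)⁻¹‖ :=
      h3.trans_le ((le_abs_self _).trans (Complex.abs_re_le_norm _))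
    rw [norm_neg, norm_inv, norm_mul, norm_pow] at this
    exact (inv_lt_inv₀ hε0 (by positivity)).1 this
  have hsq : 0 < Complex.normSq (p.1 ^ k) := Complex.normSq_pos.2 (pow_ne_zero k hx)
  have hpos : 0 < ((p.1 ^ k)⁻¹).re := (inv_pos.2 hε0).trans h1
  refine ⟨hx, hy, ?_, ?_, h4.le.trans (by gcongr), hτ.le.trans hε1.le, ?_, ?_⟩
  · refine (lt_of_pow_lt_pow_left₀ k hρ.le ?_).le
    rw [← norm_pow]
    exact hτ.trans hε2
  · refine (lt_of_pow_lt_pow_left₀ σ hρ.le ?_).le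
    have := hyσ.trans hε3
    exact lt_of_mul_lt_mul_left this hσC.le
  · rw [Complex.inv_im, Complex.inv_re, abs_div, abs_neg, abs_of_pos hsq, mul_div_assoc',
      div_lt_div_iff_of_pos_right hsq] at h2
    exact h2.le
  · rw [Complex.inv_re] at hpos
    exact (div_pos_iff_of_pos_right hsq).1 hpos

/-- With `τ = x^k`, the coordinate `1 / τ` is translated by `1`. The precision `κ / 4` keeps the
sector `|Im| < κ Re`: the imaginary part moves by at most `κ / 4`, while `κ Re` gains at least `κ (1
- κ / 4)`. -/
theorem fast_step {k : ℕ} (hk : k ≠ 0) {κ : ℝ} (hκ0 : 0 < κ) (hκ : κ ≤ 1 / 8) :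
    ∃ η > 0, ∃ ρ > 0, ∀ τ η₁ : ℂ, τ ≠ 0 → ‖τ‖ ≤ ρ → |τ.im| ≤ κ * τ.re → 0 ≤ τ.re → ‖η₁‖ ≤ η →
      ‖τ⁻¹ * ((1 + τ * (-(1 / (k : ℂ)) + η₁)) ^ k)⁻¹ - τ⁻¹ - 1‖ ≤ κ / 4 ∧
      ‖1 + τ * (-(1 / (k : ℂ)) + η₁)‖ ≤ 1 - ‖τ‖ / (2 * k) ∧
      1 - 2 * ‖τ‖ ≤ ‖1 + τ * (-(1 / (k : ℂ)) + η₁)‖ := by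
  have hk1 : (1 : ℝ) ≤ k := by exact_mod_cast Nat.one_le_iff_ne_zero.2 hk
  have hkC : (k : ℂ) ≠ 0 := by exact_mod_cast hk
  -- Linearizing the power costs `2 η` and the perturbation `η₁` costs `k η`; together they make `κ
  -- / 4`.
  set η := κ / (4 * (k + 2)) with hηd
  have hη0 : 0 < η := by positivity
  have hη1 : η * (k + 2) = κ / 4 := by
    rw [hηd]
    field_simp
  obtain ⟨δ, hδ, ha⟩ := inv_one_add_pow_approx k hη0
  refine ⟨η, hη0, min 1 (δ / 2), by positivity, fun τ η₁ hτ0 hτρ hτim hτre hη₁ => ?_⟩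
  have hτ1 : ‖τ‖ ≤ 1 := hτρ.trans (min_le_left _ _)
  have hτδ : ‖τ‖ ≤ δ / 2 := hτρ.trans (min_le_right _ _)
  set ω := τ⁻¹ with hω
  have hωτ : ω * τ = 1 := inv_mul_cancel₀ hτ0
  set ζ := τ * (-(1 / (k : ℂ)) + η₁) with hζ
  have hηs : η ≤ 1 / (4 * k) := by
    rw [le_div_iff₀ (by positivity)]
    nlinarith
  have hkn : ‖(1 / (k : ℂ))‖ ≤ 1 := by
    rw [norm_div, norm_one, Complex.norm_natCast, div_le_one (by linarith)]
    exact hk1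
  have hζn : ‖ζ‖ ≤ 2 * ‖τ‖ := by
    rw [hζ, norm_mul, mul_comm]
    have hηone : η ≤ 1 := by nlinarith
    have : ‖-(1 / (k : ℂ)) + η₁‖ ≤ 2 := by
      refine (norm_add_le _ _).trans ?_
      rw [norm_neg]
      linarith
    gcongr
  have hA := ha ζ (by linarith)
  refine ⟨?_, ?_, ?_⟩
  · have e : ω * ((1 + ζ) ^ k)⁻¹ - ω - 1 =
        ω * (((1 + ζ) ^ k)⁻¹ - 1 + k * ζ) - k * η₁ := by
      have : ω * (k * ζ) = -1 + k * η₁ := by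
        rw [hζ]
        calc ω * (k * (τ * (-(1 / (k : ℂ)) + η₁))) = (ω * τ) * (k * (-(1 / (k : ℂ)) + η₁)) := by ring
          _ = _ := by rw [hωτ]; field_simp
      linear_combination -this
    rw [e]
    refine (norm_sub_le _ _).trans ?_
    have e2 : ‖ω * (((1 + ζ) ^ k)⁻¹ - 1 + k * ζ)‖ ≤ 2 * η := by
      rw [norm_mul]
      calc ‖ω‖ * ‖((1 + ζ) ^ k)⁻¹ - 1 + k * ζ‖ ≤ ‖ω‖ * (η * (2 * ‖τ‖)) := by
            gcongr
            exact hA.trans (by gcongr)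
        _ = 2 * η * ‖ω * τ‖ := by rw [norm_mul]; ring
        _ = 2 * η := by rw [hωτ]; simp
    have e3 : ‖(k : ℂ) * η₁‖ ≤ k * η := by
      rw [norm_mul, Complex.norm_natCast]
      gcongr
    linarith
  · have hτre2 : 8 / 9 * ‖τ‖ ≤ τ.re := by
      have := norm_le_of_sector hτim hτre
      nlinarith
    have e : 1 + ζ = (1 - τ / k) + τ * η₁ := by rw [hζ]; ring
    have e1 : ‖1 - τ / k‖ ≤ 1 - 7 / 9 * ‖τ‖ / k := by
      refine (Complex.norm_le_abs_re_add_abs_im _).trans ?_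
      have r1 : (1 - τ / k).re = 1 - τ.re / k := by simp
      have r2 : (1 - τ / k).im = -(τ.im / k) := by simp
      have hle : τ.re / k ≤ 1 := by
        rw [div_le_one (by linarith)]
        exact ((le_abs_self _).trans (Complex.abs_re_le_norm τ)).trans (by linarith)
      rw [r1, r2, abs_neg, abs_div, Nat.abs_cast, abs_of_nonneg (by linarith)]
      have : |τ.im| ≤ τ.re / 8 := hτim.trans (by nlinarith)
      have h3 : |τ.im| / k ≤ τ.re / 8 / k := by gcongr
      have h4 : 7 / 9 * ‖τ‖ / k ≤ 7 / 8 * τ.re / k :=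
        div_le_div_of_nonneg_right (by linarith) (by linarith)
      have h5 : 7 / 8 * τ.re / k = τ.re / k - τ.re / 8 / k := by ring
      linarith
    rw [e]
    refine (norm_add_le _ _).trans ?_
    have e2 : ‖τ * η₁‖ ≤ ‖τ‖ * (1 / (4 * k)) := by
      rw [norm_mul]
      gcongr
      linarith
    have e3 : 7 / 9 * ‖τ‖ / k - ‖τ‖ * (1 / (4 * k)) - ‖τ‖ / (2 * k) = ‖τ‖ / (36 * k) := by
      field_simp
      norm_num
    have e4 : 0 ≤ ‖τ‖ / (36 * k) := by positivity
    linarith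
  · have := norm_sub_le (1 + ζ) ζ
    simp only [add_sub_cancel_right, norm_one] at this
    linarith

/-- The coordinate `-1 / (σ C y^σ)` is translated by approximately `τ`. The second bound says that
`‖y‖^(σ+1)` loses no more than the factor `1 - ‖τ‖ / (2k)` that `fast_step` takes from `‖x‖`. -/
theorem slow_step {k σ : ℕ} (hk : k ≠ 0) (hσ : σ ≠ 0) {C : ℂ} (hC : C ≠ 0) :
    ∃ η > 0, ∃ ρ > 0, ∀ τ y η₂ : ℂ, y ≠ 0 → ‖τ‖ ≤ ρ → ‖y‖ ≤ ρ → ‖η₂‖ ≤ η →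
      ‖-(σ * C * (y * (1 + τ * y ^ σ * (C + η₂))) ^ σ)⁻¹ - -(σ * C * y ^ σ)⁻¹ - τ‖ ≤ ‖τ‖ / 4 ∧
      1 - ‖τ‖ / (2 * k) ≤ ‖1 + τ * y ^ σ * (C + η₂)‖ ^ (σ + 1) := by
  have hk1 : (1 : ℝ) ≤ k := by exact_mod_cast Nat.one_le_iff_ne_zero.2 hk
  have hσ1 : (1 : ℝ) ≤ σ := by exact_mod_cast Nat.one_le_iff_ne_zero.2 hσ
  have hσC : (σ : ℂ) ≠ 0 := by exact_mod_cast hσ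
  have hC0 : 0 < ‖C‖ := norm_pos_iff.2 hC
  obtain ⟨δ, hδ, ha⟩ := inv_one_add_pow_approx σ (show (0 : ℝ) < 1 / 16 by norm_num)
  -- Chosen so that `(σ + 1) ‖ζ‖ ≤ ‖τ‖ ρ M / (2k)`, which Bernoulli's inequality needs with `ρ M ≤
  -- 1`.
  set M : ℝ := (σ + 1) * (k * (4 * ‖C‖)) with hM
  have hM0 : 0 < M := by positivity
  have hCM : 2 * ‖C‖ ≤ M := by
    have h2 : 2 * ‖C‖ ≤ k * (4 * ‖C‖) := by nlinarith
    rw [hM]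
    nlinarith
  refine ⟨‖C‖ / 8, by positivity, min 1 (min (δ / M) (1 / M)), by positivity,
    fun τ y η₂ hy hτρ hyρ hη₂ => ?_⟩
  set ρ := min 1 (min (δ / M) (1 / M))
  have hρ1 : ρ ≤ 1 := min_le_left _ _
  have hρδ : ρ * M ≤ δ := (le_div_iff₀ hM0).1 ((min_le_right _ _).trans (min_le_left _ _))
  have hρM : ρ * M ≤ 1 := (le_div_iff₀ hM0).1 ((min_le_right _ _).trans (min_le_right _ _))
  have hρ0 : 0 ≤ ρ := (norm_nonneg τ).trans hτρ
  set ζ := τ * y ^ σ * (C + η₂) with hζ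
  have hyσ : ‖y‖ ^ σ ≤ ρ :=
    (pow_le_of_le_one (norm_nonneg y) (hyρ.trans hρ1) hσ).trans hyρ
  have hCη : ‖C + η₂‖ ≤ 2 * ‖C‖ := (norm_add_le _ _).trans (by linarith)
  have hζn : ‖ζ‖ ≤ ‖τ‖ * (ρ * (2 * ‖C‖)) := by
    rw [hζ, norm_mul, norm_mul, norm_pow y, mul_assoc]
    gcongr
  have hζM : ‖ζ‖ ≤ ρ * M := by
    refine hζn.trans ?_
    calc ‖τ‖ * (ρ * (2 * ‖C‖)) ≤ 1 * (ρ * M) := by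
          gcongr
          exact hτρ.trans hρ1
      _ = ρ * M := one_mul _
  refine ⟨?_, ?_⟩
  · have hB := ha ζ (hζM.trans hρδ)
    set s := -(σ * C * y ^ σ)⁻¹ with hs
    have hyσ0 : y ^ σ ≠ 0 := pow_ne_zero σ hy
    have hs' : -(σ * C * (y * (1 + ζ)) ^ σ)⁻¹ = s * ((1 + ζ) ^ σ)⁻¹ := by
      rw [hs, mul_pow, ← mul_assoc, mul_inv, neg_mul]
    have hsζ : s * (σ * ζ) = -(τ + τ * (η₂ / C)) := by
      rw [hs, hζ]
      field_simp
    have e : -(σ * C * (y * (1 + ζ)) ^ σ)⁻¹ - s - τ =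
        s * (((1 + ζ) ^ σ)⁻¹ - 1 + σ * ζ) + τ * (η₂ / C) := by
      rw [hs']
      linear_combination -hsζ
    rw [e]
    refine (norm_add_le _ _).trans ?_
    have hη₂C : ‖η₂ / C‖ ≤ 1 / 8 := by
      rw [norm_div, div_le_iff₀ hC0]
      linarith
    have e2 : ‖τ * (η₂ / C)‖ ≤ ‖τ‖ * (1 / 8) := by
      rw [norm_mul]
      gcongr
    have e3 : ‖s * (((1 + ζ) ^ σ)⁻¹ - 1 + σ * ζ)‖ ≤ ‖τ‖ * (1 / 8) := by
      have h1 : ‖s‖ * ‖ζ‖ ≤ ‖s * (σ * ζ)‖ := by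
        rw [norm_mul s, norm_mul (σ : ℂ), Complex.norm_natCast]
        exact mul_le_mul_of_nonneg_left (le_mul_of_one_le_left (norm_nonneg ζ) hσ1) (norm_nonneg s)
      have h2 : ‖s * (σ * ζ)‖ ≤ 2 * ‖τ‖ := by
        rw [hsζ, norm_neg]
        refine (norm_add_le _ _).trans ?_
        linarith [norm_nonneg τ]
      rw [norm_mul]
      calc ‖s‖ * ‖((1 + ζ) ^ σ)⁻¹ - 1 + σ * ζ‖ ≤ ‖s‖ * (1 / 16 * ‖ζ‖) := by gcongr
        _ = 1 / 16 * (‖s‖ * ‖ζ‖) := by ring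
        _ ≤ 1 / 16 * (2 * ‖τ‖) := mul_le_mul_of_nonneg_left (h1.trans h2) (by norm_num)
        _ = _ := by ring
    linarith
  · have h1 : 1 - ‖ζ‖ ≤ ‖1 + ζ‖ := by
      have := norm_sub_le (1 + ζ) ζ
      simp only [add_sub_cancel_right, norm_one] at this
      linarith
    have h0 : ‖ζ‖ ≤ 1 := hζM.trans hρM
    have h2 := one_add_mul_le_pow (a := -‖ζ‖) (by linarith) (σ + 1)
    have h3 : (1 + -‖ζ‖) ^ (σ + 1) ≤ ‖1 + ζ‖ ^ (σ + 1) :=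
      pow_le_pow_left₀ (by linarith) (by linarith) _
    have h4 : (σ + 1) * ‖ζ‖ ≤ ‖τ‖ / (2 * k) := by
      rw [le_div_iff₀ (by linarith)]
      calc (σ + 1) * ‖ζ‖ * (2 * k) ≤ (σ + 1) * (‖τ‖ * (ρ * (2 * ‖C‖))) * (2 * k) := by gcongr
        _ = ‖τ‖ * (ρ * M) := by rw [hM]; ring
        _ ≤ ‖τ‖ * 1 := by gcongr
        _ = ‖τ‖ := mul_one _
    push_cast at h2
    linarith

/-- The tolerance `η` does not depend on `ε`: the petal may be shrunk afterwards until the actual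
error terms are below `η`. -/
theorem petal_step {k σ : ℕ} (hk : k ≠ 0) (hσ : σ ≠ 0) {C : ℂ} (hC : C ≠ 0) {κ : ℝ} (hκ0 : 0 < κ)
    (hκ : κ ≤ 1 / 8) : ∃ η > 0, ∀ᶠ ε in 𝓝[>] (0 : ℝ), ∀ x y η₁ η₂ : ℂ, ‖η₁‖ ≤ η → ‖η₂‖ ≤ η →
      (x, y) ∈ petal k σ C κ ε →
      (x * (1 + x ^ k * (-(1 / (k : ℂ)) + η₁)), y * (1 + x ^ k * y ^ σ * (C + η₂)))
        ∈ petal k σ C κ ε ∧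
      ((x ^ k)⁻¹).re + 1 / 2 ≤ (((x * (1 + x ^ k * (-(1 / (k : ℂ)) + η₁))) ^ k)⁻¹).re ∧
      ‖x‖ * (1 - 2 * ‖x ^ k‖) ≤ ‖x * (1 + x ^ k * (-(1 / (k : ℂ)) + η₁))‖ := by
  obtain ⟨ηf, hηf, ρf, hρf, hfast⟩ := fast_step hk hκ0 hκ
  obtain ⟨ηs, hηs, ρs, hρs, hslow⟩ := slow_step hk hσ hC
  refine ⟨min ηf ηs, lt_min hηf hηs, ?_⟩
  filter_upwards [petal_small hk hσ hC κ (lt_min (lt_min hρf hρs) one_pos), self_mem_nhdsWithin]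
    with ε hsm hε0 x y η₁ η₂ hη₁ hη₂ hp
  have hε0 : 0 < ε := hε0
  obtain ⟨hx, hy, -, hyρ, -, hτρ, hτim, hτre⟩ := hsm _ hp
  obtain ⟨p1, p2, p3, p4⟩ := hp
  simp only at hx hy hyρ hτρ hτim hτre p1 p2 p3 p4
  have hτ1 : ‖x ^ k‖ ≤ 1 := hτρ.trans (min_le_right _ _)
  have hτρ := hτρ.trans (min_le_left _ _)
  have hyρ := hyρ.trans (min_le_left _ _)
  obtain ⟨f1, f2, f3⟩ := hfast (x ^ k) η₁ (pow_ne_zero k hx) (hτρ.trans (min_le_left _ _)) hτim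
    hτre.le (hη₁.trans (min_le_left _ _))
  obtain ⟨s1, s2⟩ := hslow (x ^ k) y η₂ hy (hτρ.trans (min_le_right _ _))
    (hyρ.trans (min_le_right _ _)) (hη₂.trans (min_le_right _ _))
  rw [← mul_inv, ← mul_pow] at f1
  set τ := x ^ k with hτ
  set ω := τ⁻¹ with hω
  set ζ := τ * (-(1 / (k : ℂ)) + η₁) with hζ
  set ζ₂ := τ * y ^ σ * (C + η₂) with hζ₂
  have hωre := (Complex.abs_re_le_norm _).trans f1
  have hωim := (Complex.abs_im_le_norm _).trans f1
  simp only [Complex.sub_re, Complex.one_re, Complex.sub_im, Complex.one_im, sub_zero] at hωre hωim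
  rw [abs_le] at hωre
  have hωim2 : |(((x * (1 + ζ)) ^ k)⁻¹).im| ≤ |ω.im| + κ / 4 := by
    have := abs_sub_abs_le_abs_sub (((x * (1 + ζ)) ^ k)⁻¹).im ω.im
    linarith
  -- The translation `τ` has `‖τ‖ ≤ (1 + κ) Re τ`, so an error `‖τ‖ / 4` cannot make the real part
  -- decrease.
  have hsre : (-(σ * C * y ^ σ)⁻¹).re ≤ (-(σ * C * (y * (1 + ζ₂)) ^ σ)⁻¹).re := by
    have := (Complex.abs_re_le_norm _).trans s1
    rw [abs_le, Complex.sub_re, Complex.sub_re] at this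
    have h2 := norm_le_of_sector hτim hτre.le
    have h3 : κ * τ.re ≤ 1 / 8 * τ.re := by gcongr
    linarith [this.1]
  refine ⟨⟨?_, ?_, p3.trans_le hsre, ?_⟩, ?_, ?_⟩
  · change ε⁻¹ < (((x * (1 + ζ)) ^ k)⁻¹).re
    linarith [hωre.1]
  · change |(((x * (1 + ζ)) ^ k)⁻¹).im| < κ * (((x * (1 + ζ)) ^ k)⁻¹).re
    have h1 : κ * (ω.re + 1 - κ / 4) ≤ κ * (((x * (1 + ζ)) ^ k)⁻¹).re := by
      gcongr
      linarith [hωre.1]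
    have h2 : κ * κ ≤ κ * (1 / 8) := by gcongr
    linarith
  · change ‖x * (1 + ζ)‖ < ε * ‖y * (1 + ζ₂)‖ ^ (σ + 1)
    rw [norm_mul, norm_mul, mul_pow, ← mul_assoc]
    have hpos : 0 < 1 - ‖τ‖ / (2 * k) := by
      have hk1 : (1 : ℝ) ≤ k := by exact_mod_cast Nat.one_le_iff_ne_zero.2 hk
      have : ‖τ‖ / (2 * k) ≤ 1 / 2 := by
        rw [div_le_iff₀ (by linarith)]
        linarith
      linarith
    calc ‖x‖ * ‖1 + ζ‖ ≤ ‖x‖ * (1 - ‖τ‖ / (2 * k)) := by gcongr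
      _ < ε * ‖y‖ ^ (σ + 1) * (1 - ‖τ‖ / (2 * k)) := by gcongr
      _ ≤ _ := by gcongr
  · linarith [hωre.1]
  · rw [norm_mul]
    gcongr

/-! ### Error terms in the blow-up coordinates. -/

theorem eventually_forall_norm_le {p : ℂ → Prop} (h : ∀ᶠ y in 𝓝 0, p y) :
    ∀ᶠ ρ in 𝓝[>] (0 : ℝ), ∀ y, ‖y‖ ≤ ρ → p y := by
  obtain ⟨δ, hδ, h1⟩ := Metric.eventually_nhds_iff.1 h
  filter_upwards [(eventually_lt_nhds hδ).filter_mono nhdsWithin_le_nhds] with ρ hρ y hy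
  exact h1 (by rw [dist_zero_right]; linarith)

theorem eventually_const_mul_le (c : ℝ) {η : ℝ} (hη : 0 < η) :
    ∀ᶠ ρ in 𝓝[>] (0 : ℝ), c * ρ ≤ η := by
  have : Tendsto (fun ρ : ℝ => c * ρ) (𝓝 0) (𝓝 (c * 0)) :=
    (continuous_const.mul continuous_id).tendsto 0
  rw [mul_zero] at this
  exact (this.eventually_le_const hη).filter_mono nhdsWithin_le_nhds

/-- Errors of size `‖x‖^(k+2)` in the two monomials become relative perturbations of the model. For
`x` the relative error is `O(‖x‖)`; for `y` it is `O(‖x‖ / ‖y‖^(σ+1))`, because the leading term of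
the quotient carries `y^(σ+1)`. This is where `‖x‖ ≤ ρ ‖y‖^(σ+1)` is needed. -/
theorem perturbed_step {k σ : ℕ} (hk : k ≠ 0) {u₀ C : ℂ} {G₁ G₂ h : ℂ → ℂ}
    (hG : ContinuousAt G₁ 0) (hG0 : G₁ 0 = -(1 / (k : ℂ))) (hh : ContinuousAt h 0) (hh0 : h 0 = C)
    (hg : ∀ᶠ y in 𝓝 0, (u₀ + y) * (G₂ y - G₁ y) = y ^ (σ + 1) * h y) (K : ℝ) {η : ℝ} (hη : 0 < η) :
    ∀ᶠ ρ in 𝓝[>] (0 : ℝ), ∀ x y x' Y' : ℂ, x ≠ 0 → y ≠ 0 → ‖x‖ ≤ ρ → ‖y‖ ≤ ρ →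
      ‖x‖ ≤ ρ * ‖y‖ ^ (σ + 1) → ‖x ^ k‖ ≤ ρ →
      ‖x' - x * (1 + x ^ k * G₁ y)‖ ≤ K * ‖x‖ ^ (k + 2) →
      ‖Y' - x * (u₀ + y) * (1 + x ^ k * G₂ y)‖ ≤ K * ‖x‖ ^ (k + 2) →
      ∃ η₁ η₂ : ℂ, ‖η₁‖ ≤ η ∧ ‖η₂‖ ≤ η ∧ x' = x * (1 + x ^ k * (-(1 / (k : ℂ)) + η₁)) ∧
        Y' / x' - u₀ = y * (1 + x ^ k * y ^ σ * (C + η₂)) := by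
  have hk1 : (1 : ℝ) ≤ k := by exact_mod_cast Nat.one_le_iff_ne_zero.2 hk
  have hη8 : 0 < η / 8 := by positivity
  have hG' : ∀ᶠ y in 𝓝 0, ‖G₁ y + 1 / (k : ℂ)‖ < η / 2 := by
    have := (hG.tendsto.add_const (1 / (k : ℂ))).norm
    rw [hG0, neg_add_cancel, norm_zero] at this
    exact this.eventually_lt_const (half_pos hη)
  have hh' : ∀ᶠ y in 𝓝 0, ‖h y - C‖ < η / 8 := by
    have := (hh.tendsto.sub_const C).norm
    rw [hh0, sub_self, norm_zero] at this
    exact this.eventually_lt_const hη8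
  filter_upwards [eventually_forall_norm_le hG', eventually_forall_norm_le hh',
    eventually_forall_norm_le hg, eventually_const_mul_le K (half_pos hη),
    eventually_const_mul_le (K * (2 + ‖u₀‖)) hη8, eventually_const_mul_le ((1 + η) * ‖C‖) hη8,
    eventually_const_mul_le (1 + η) (show (0 : ℝ) < 1 / 2 by norm_num),
    eventually_const_mul_le 1 one_pos]
    with ρ r1 r2 r3 r4 r5 r6 r7 r8 x y x' Y' hx hy hxρ hyρ hxy hτρ hx' hY'
  have hxn : 0 < ‖x‖ := norm_pos_iff.2 hx
  have hyn : 0 < ‖y‖ := norm_pos_iff.2 hy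
  have hK : 0 ≤ K := by
    by_contra hc
    have := mul_neg_of_neg_of_pos (not_le.1 hc) (pow_pos hxn (k + 2))
    exact absurd ((norm_nonneg _).trans hx') (not_le.2 this)
  set τ := x ^ k with hτ
  have hτ0 : τ ≠ 0 := pow_ne_zero k hx
  have hτn : 0 < ‖τ‖ := norm_pos_iff.2 hτ0
  have hpow : ‖x‖ ^ (k + 2) = ‖x‖ * (‖x‖ * ‖τ‖) := by rw [hτ, norm_pow]; ring
  set e₁ := x' - x * (1 + τ * G₁ y) with he₁
  set e₂ := Y' - x * (u₀ + y) * (1 + τ * G₂ y) with he₂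
  set η₁ := G₁ y + 1 / (k : ℂ) + e₁ / (x * τ) with hη₁d
  have hη₁ : ‖η₁‖ ≤ η := by
    have h1 : ‖e₁ / (x * τ)‖ ≤ η / 2 := by
      rw [norm_div, norm_mul, div_le_iff₀ (by positivity)]
      refine hx'.trans ?_
      rw [hpow, ← mul_assoc]
      have : K * ‖x‖ ≤ η / 2 := (mul_le_mul_of_nonneg_left hxρ hK).trans r4
      gcongr
    have := r1 y hyρ
    exact (norm_add_le _ _).trans (by linarith)
  set X := τ * (-(1 / (k : ℂ)) + η₁) with hX
  have hx'e : x' = x * (1 + X) := by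
    have h1 : x * (τ * (e₁ / (x * τ))) = e₁ := by field_simp
    rw [hX, hη₁d]
    linear_combination he₁ - h1
  have hXn : ‖X‖ ≤ (1 + η) * ρ := by
    rw [hX, norm_mul, mul_comm]
    have hkn : ‖(1 / (k : ℂ))‖ ≤ 1 := by
      rw [norm_div, norm_one, Complex.norm_natCast, div_le_one (by linarith)]
      exact hk1
    have : ‖-(1 / (k : ℂ)) + η₁‖ ≤ 1 + η := by
      refine (norm_add_le _ _).trans ?_
      rw [norm_neg]
      linarith
    gcongr
  have hX1 : 1 / 2 ≤ ‖1 + X‖ := by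
    have := norm_sub_le (1 + X) X
    simp only [add_sub_cancel_right, norm_one] at this
    linarith
  have hX0 : 1 + X ≠ 0 := norm_pos_iff.1 (by linarith)
  have hx'0 : x' ≠ 0 := by rw [hx'e]; exact mul_ne_zero hx hX0
  -- The error in `Y' - (u₀ + y) x'`, measured against its leading term `x τ y^(σ+1)`.
  set B := (e₂ - (u₀ + y) * e₁) / (x * τ * y ^ (σ + 1)) with hB
  have hym : y ^ (σ + 1) ≠ 0 := pow_ne_zero _ hy
  have hBn : ‖B‖ ≤ η / 8 := by
    rw [hB, norm_div, norm_mul, norm_mul, norm_pow y, div_le_iff₀ (by positivity)]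
    have h1 : ‖u₀ + y‖ ≤ 1 + ‖u₀‖ := by linarith [norm_add_le u₀ y]
    calc ‖e₂ - (u₀ + y) * e₁‖ ≤ ‖e₂‖ + ‖u₀ + y‖ * ‖e₁‖ := by
          rw [← norm_mul]; exact norm_sub_le _ _
      _ ≤ K * ‖x‖ ^ (k + 2) + (1 + ‖u₀‖) * (K * ‖x‖ ^ (k + 2)) := by gcongr
      _ = K * (2 + ‖u₀‖) * ‖x‖ * (‖x‖ * ‖τ‖) := by rw [hpow]; ring
      _ ≤ K * (2 + ‖u₀‖) * (ρ * ‖y‖ ^ (σ + 1)) * (‖x‖ * ‖τ‖) := by gcongr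
      _ = K * (2 + ‖u₀‖) * ρ * (‖x‖ * ‖τ‖ * ‖y‖ ^ (σ + 1)) := by ring
      _ ≤ η / 8 * (‖x‖ * ‖τ‖ * ‖y‖ ^ (σ + 1)) := by gcongr
  set η₂ := (h y + B) / (1 + X) - C with hη₂d
  have hη₂ : ‖η₂‖ ≤ η := by
    have h1 : η₂ = ((h y - C) + B - C * X) / (1 + X) := by
      rw [hη₂d]
      field_simp
      ring
    have h2 : ‖C * X‖ ≤ η / 8 := by
      rw [norm_mul]
      calc ‖C‖ * ‖X‖ ≤ ‖C‖ * ((1 + η) * ρ) := by gcongr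
        _ = (1 + η) * ‖C‖ * ρ := by ring
        _ ≤ η / 8 := r6
    have h3 : ‖(h y - C) + B - C * X‖ ≤ η / 2 := by
      refine (norm_sub_le _ _).trans ?_
      have := norm_add_le (h y - C) B
      have := r2 y hyρ
      linarith
    rw [h1, norm_div, div_le_iff₀ (by linarith)]
    nlinarith
  refine ⟨η₁, η₂, hη₁, hη₂, hx'e, ?_⟩
  have hBe : e₂ - (u₀ + y) * e₁ = x * τ * y ^ (σ + 1) * B := by
    rw [hB]
    field_simp
  have hCη : (C + η₂) * (1 + X) = h y + B := by
    rw [hη₂d]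
    field_simp
    ring
  have hmain : Y' = x' * (u₀ + y * (1 + τ * y ^ σ * (C + η₂))) := by
    have h1 : Y' - (u₀ + y) * x' = x * τ * y ^ (σ + 1) * (h y + B) := by
      linear_combination hBe + x * τ * r3 y hyρ - he₂ + (u₀ + y) * he₁
    rw [← hCη] at h1
    linear_combination h1 - τ * y ^ (σ + 1) * (C + η₂) * hx'e
  rw [hmain]
  field_simp
  ring

/-! ### The invariant region in the full space. -/

/-- Bernoulli's inequality applied to `(1 + ct)^N`, whose product with `(1 - ct)^N` is at most one,
and then `1 / (1 + s) ≤ 1 - s / 2` for `s = Nct ≤ 1`. It trades the contraction rate `c` for the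
rate `2` by raising to the power `N`. -/
theorem one_sub_pow_le {c t : ℝ} {N : ℕ} (hN : 4 ≤ N * c) (h0 : 0 ≤ t) (h1 : N * c * t ≤ 1)
    (h2 : c * t ≤ 1) (hc : 0 ≤ c) : (1 - c * t) ^ N ≤ 1 - 2 * t := by
  have hB := one_add_mul_le_pow (a := c * t) (by nlinarith [mul_nonneg hc h0]) N
  have hct := mul_nonneg hc h0
  have hprod : (1 - c * t) ^ N * (1 + c * t) ^ N ≤ 1 := by
    rw [← mul_pow]
    refine pow_le_one₀ (mul_nonneg (by linarith) (by linarith)) ?_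
    nlinarith
  have hp : 0 ≤ (1 - c * t) ^ N := pow_nonneg (by linarith) N
  set s := N * (c * t) with hs
  have hs1 : s ≤ 1 := by rw [hs]; linarith
  have hs4 : 4 * t ≤ s := by rw [hs]; nlinarith
  have hs0 : 0 ≤ s := by positivity
  have h3 : (1 - c * t) ^ N * (1 + s) ≤ 1 := (mul_le_mul_of_nonneg_left hB hp).trans hprod
  have h4 : (1 : ℝ) ≤ (1 - s / 2) * (1 + s) := by nlinarith
  have h5 : (1 - c * t) ^ N ≤ 1 - s / 2 := by
    by_contra hcon
    have := mul_lt_mul_of_pos_right (not_le.1 hcon) (show 0 < 1 + s by linarith)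
    linarith
  linarith

theorem exists_common_bound {E ι : Type*} [TopologicalSpace E] [Zero E] [Fintype ι]
    {f : ι → E → ℂ} {g : ι → E → ℝ} (h : ∀ i, f i =O[𝓝 0] g i) :
    ∃ K, 0 ≤ K ∧ ∀ᶠ z in 𝓝 0, ∀ i, ‖f i z‖ ≤ K * ‖g i z‖ := by
  choose c hc0 hc using fun i => (h i).exists_nonneg
  refine ⟨∑ i, c i, Finset.sum_nonneg fun i _ => hc0 i, ?_⟩
  rw [eventually_all]
  intro i
  filter_upwards [(hc i).bound] with z hz
  refine hz.trans ?_
  gcongr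
  exact Finset.single_le_sum (fun j _ => hc0 j) (Finset.mem_univ i)

/-- The blow-up coordinates of the pair of resonant monomials near the direction `v`. -/
def chart {n : ℕ} (P Q : Fin n → ℕ) (v : ℂ × ℂ) (w : Fin n → ℂ) : ℂ × ℂ :=
  (mono w P / v.1, mono w Q / mono w P - v.2 / v.1)

/-- The basin, in normalizing coordinates. -/
def basinRegion {n : ℕ} (P Q : Fin n → ℕ) (v : ℂ × ℂ) (k σ : ℕ) (C : ℂ) (κ : ℝ) (N : ℕ) (ε : ℝ) :
    Set (Fin n → ℂ) :=
  {w | chart P Q v w ∈ petal k σ C κ ε ∧ ‖w‖ ^ N < ‖(chart P Q v w).1‖}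

theorem resMono_eq_of_chart {n : ℕ} {P Q : Fin n → ℕ} {v : ℂ × ℂ} (hv : v.1 ≠ 0) {w : Fin n → ℂ}
    (hx : (chart P Q v w).1 ≠ 0) :
    resMono P Q w = ((chart P Q v w).1 * v.1,
      (chart P Q v w).1 * (v.2 + v.1 * (chart P Q v w).2)) := by
  have hP : mono w P ≠ 0 := by
    intro h0
    exact hx (by simp [chart, h0])
  simp only [resMono, chart]
  ext
  · simp only
    field_simp
  · simp only
    field_simp
    ring

theorem resMono_norm_le_of_chart {n : ℕ} {P Q : Fin n → ℕ} {v : ℂ × ℂ} (hv : v.1 ≠ 0)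
    {w : Fin n → ℂ} (hx : (chart P Q v w).1 ≠ 0) (hy : ‖(chart P Q v w).2‖ ≤ 1) :
    ‖resMono P Q w‖ ≤ (‖v.1‖ + ‖v.2‖) * ‖(chart P Q v w).1‖ := by
  rw [resMono_eq_of_chart hv hx, Prod.norm_mk, norm_mul, norm_mul, mul_comm (‖v.1‖ + ‖v.2‖)]
  refine max_le ?_ ?_
  · gcongr
    exact le_add_of_nonneg_right (norm_nonneg _)
  · gcongr
    refine (norm_add_le _ _).trans ?_
    rw [norm_mul, add_comm]
    gcongr
    exact mul_le_of_le_one_right (norm_nonneg _) hy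

/-- Coordinates with `|λ_j| = 1` shrink by `1 - κ |x^k|`, and the error is a small multiple of `‖w‖
|x^k|`, which costs half the rate. The remaining coordinates shrink by a fixed factor, more than is
required for small `x`. -/
theorem fiber_contraction {n r k l N : ℕ} {F Φ : (Fin n → ℂ) → (Fin n → ℂ)} {lam : Fin n → ℂ}
    {P Q : Fin n → ℕ} {fib : Fin n → ℂ × ℂ → ℂ} (h : IsShadowed F lam r P Q fib k l Φ)
    (hhom : ∀ j (c : ℂ) (u : ℂ × ℂ), fib j (c * u.1, c * u.2) = c ^ k * fib j u)
    (hcont : ∀ j, Continuous (fib j)) {v : ℂ × ℂ} (hv : v.1 ≠ 0)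
    (h_one : ∀ j : Fin n, j.val < r → ‖lam j‖ = 1) (h_lt : ∀ j : Fin n, r ≤ j.val → ‖lam j‖ < 1)
    {κ : ℝ} (hκ0 : 0 < κ)
    (hκ : ∀ j : Fin n, j.val < r → ∀ τ f : ℂ, ‖τ‖ ≤ κ → |τ.im| ≤ κ * τ.re →
      ‖f - fib j v‖ ≤ κ → ‖1 + τ * f‖ ≤ 1 - κ * ‖τ‖)
    (hN0 : N ≠ 0) (hl : N * (k + 2) ≤ l) :
    ∃ U ∈ 𝓝 (0 : Fin n → ℂ), ∀ᶠ ρ in 𝓝[>] (0 : ℝ), ∀ z ∈ U,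
      (chart P Q v (Φ z)).1 ≠ 0 → ‖(chart P Q v (Φ z)).1‖ ≤ ρ → ‖(chart P Q v (Φ z)).2‖ ≤ ρ →
      ‖(chart P Q v (Φ z)).1 ^ k‖ ≤ ρ →
      |((chart P Q v (Φ z)).1 ^ k).im| ≤ κ * ((chart P Q v (Φ z)).1 ^ k).re →
      ‖Φ z‖ ^ N < ‖(chart P Q v (Φ z)).1‖ →
      ‖Φ (F z)‖ ≤ ‖Φ z‖ * (1 - κ / 2 * ‖(chart P Q v (Φ z)).1 ^ k‖) := by
  obtain ⟨K, hK, hfib⟩ := exists_common_bound fun j : {j : Fin n // j.val < r} => h.fiber j j.2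
  obtain ⟨K', hK', hcon⟩ := exists_common_bound fun j : {j : Fin n // r ≤ j.val} => h.contract j j.2
  refine ⟨_, hfib.and hcon, ?_⟩
  -- A uniform spectral gap; half of `d` absorbs the quadratic error and half the factor `1 - κ ‖τ‖
  -- / 2`.
  have hgap : ∀ᶠ d in 𝓝[>] (0 : ℝ), ∀ j : Fin n, r ≤ j.val → ‖lam j‖ + d ≤ 1 := by
    rw [eventually_all]
    intro j
    by_cases hj : r ≤ j.val
    · filter_upwards [(eventually_lt_nhds (sub_pos.2 (h_lt j hj))).filter_mono nhdsWithin_le_nhds]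
        with d hd _
      linarith
    · exact Eventually.of_forall fun _ h => absurd h hj
  obtain ⟨d, hd, hd0⟩ := (hgap.and self_mem_nhdsWithin).exists
  have hd0 : 0 < d := hd0
  have hφ : ∀ᶠ y in 𝓝 (0 : ℂ), ∀ j, ‖fib j (v.1, v.2 + v.1 * y) - fib j v‖ < κ := by
    rw [eventually_all]
    intro j
    have hc : Continuous fun y : ℂ => ‖fib j (v.1, v.2 + v.1 * y) - fib j v‖ := by
      have := hcont j
      fun_prop
    exact (hc.tendsto 0).eventually_lt_const (by simpa using hκ0)
  set M := ‖v.1‖ + ‖v.2‖ with hM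
  have hM0 : 0 ≤ M := by positivity
  obtain ⟨ρw, hρw, hρw0⟩ := ((eventually_const_mul_le K' (half_pos hd0)).and
    self_mem_nhdsWithin).exists
  have hρw0 : 0 < ρw := hρw0
  filter_upwards [eventually_forall_norm_le hφ, eventually_const_mul_le 1 one_pos,
    eventually_const_mul_le 1 hκ0, eventually_const_mul_le (K * (M ^ (k + 1) + 1)) (half_pos hκ0),
    eventually_const_mul_le (κ / 2) (half_pos hd0),
    eventually_const_mul_le 1 (pow_pos hρw0 N), eventually_const_mul_le (κ / 2) one_pos]
    with ρ r1 r2 r3 r4 r5 r6 r7 z hz hx hxρ hyρ hτρ hτim hwN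
  obtain ⟨hzf, hzc⟩ := hz
  set w := Φ z with hw
  have hU := resMono_eq_of_chart hv hx
  have hUn := resMono_norm_le_of_chart hv hx (hyρ.trans (by linarith))
  set x := (chart P Q v w).1
  set y := (chart P Q v w).2
  set τ := x ^ k with hτ
  have hxn : 0 < ‖x‖ := norm_pos_iff.2 hx
  have hwρ : ‖w‖ ≤ ρw := (lt_of_pow_lt_pow_left₀ N hρw0.le (by linarith)).le
  have hw1 : ‖w‖ ≤ 1 := by
    refine (lt_of_pow_lt_pow_left₀ N zero_le_one ?_).le
    rw [one_pow]
    rcases (show ‖x‖ ≤ 1 by linarith).lt_or_eq with h1 | h1 <;> linarith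
  -- One factor `‖w‖` is kept aside, so that the error remains relative to `‖w‖`.
  have hwl : ‖w‖ ^ l ≤ ‖w‖ * ‖x‖ ^ (k + 1) := by
    have h1 : N * (k + 1) + 1 ≤ l := by
      have : 1 ≤ N := Nat.one_le_iff_ne_zero.2 hN0
      nlinarith
    calc ‖w‖ ^ l ≤ ‖w‖ ^ (N * (k + 1) + 1) := pow_le_pow_of_le_one (norm_nonneg _) hw1 h1
      _ = ‖w‖ * (‖w‖ ^ N) ^ (k + 1) := by rw [pow_succ, pow_mul, mul_comm]
      _ ≤ ‖w‖ * ‖x‖ ^ (k + 1) := by gcongr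
  have hτ0 := norm_nonneg τ
  have hτ1 : κ / 2 * ‖τ‖ ≤ d / 2 := by
    calc κ / 2 * ‖τ‖ ≤ κ / 2 * ρ := by gcongr
      _ ≤ d / 2 := r5
  have hτ2 : κ / 2 * ‖τ‖ ≤ 1 := by
    calc κ / 2 * ‖τ‖ ≤ κ / 2 * ρ := by gcongr
      _ ≤ 1 := r7
  have hnn : 0 ≤ ‖w‖ * (1 - κ / 2 * ‖τ‖) := mul_nonneg (norm_nonneg _) (by linarith)
  rw [pi_norm_le_iff_of_nonneg hnn]
  intro j
  have hwj : ‖w j‖ ≤ ‖w‖ := norm_le_pi_norm w j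
  by_cases hj : j.val < r
  · have hb := hzf ⟨j, hj⟩
    simp only at hb
    have hfj : fib j (resMono P Q w) = τ * fib j (v.1, v.2 + v.1 * y) := by
      rw [hU, hhom j x (v.1, v.2 + v.1 * y)]
    rw [hfj, Real.norm_of_nonneg (by positivity)] at hb
    have hc := hκ j hj τ (fib j (v.1, v.2 + v.1 * y)) (by linarith) hτim (r1 y hyρ j).le
    have h1 : ‖lam j * (w j * (1 + τ * fib j (v.1, v.2 + v.1 * y)))‖ ≤ ‖w‖ * (1 - κ * ‖τ‖) := by
      rw [norm_mul, norm_mul, h_one j hj, one_mul]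
      gcongr
    have h2 : K * (‖w‖ * ‖resMono P Q w‖ ^ (k + 1) + ‖w‖ ^ l) ≤ ‖w‖ * (κ / 2 * ‖τ‖) := by
      calc K * (‖w‖ * ‖resMono P Q w‖ ^ (k + 1) + ‖w‖ ^ l)
          ≤ K * (‖w‖ * (M * ‖x‖) ^ (k + 1) + ‖w‖ * ‖x‖ ^ (k + 1)) := by gcongr
        _ = ‖w‖ * (K * (M ^ (k + 1) + 1) * ‖x‖ * ‖τ‖) := by
          rw [hτ, norm_pow, mul_pow, pow_succ ‖x‖]
          ring
        _ ≤ ‖w‖ * (κ / 2 * ‖τ‖) := by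
          gcongr
          exact (mul_le_mul_of_nonneg_left hxρ (by positivity)).trans r4
    have h3 := norm_add_le (Φ (F z) j - lam j * (w j * (1 + τ * fib j (v.1, v.2 + v.1 * y))))
      (lam j * (w j * (1 + τ * fib j (v.1, v.2 + v.1 * y))))
    rw [sub_add_cancel] at h3
    linarith
  · have hj := not_lt.1 hj
    have hb := hzc ⟨j, hj⟩
    simp only at hb
    rw [Real.norm_of_nonneg (by positivity)] at hb
    have h3 := norm_add_le (Φ (F z) j - lam j * w j) (lam j * w j)
    rw [sub_add_cancel, norm_mul] at h3
    have h4 : K' * ‖w‖ ≤ d / 2 := (mul_le_mul_of_nonneg_left hwρ hK').trans hρw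
    have h5 := hd j hj
    have h6 : ‖lam j‖ * ‖w j‖ ≤ ‖lam j‖ * ‖w‖ := by gcongr
    have h7 : (K' * ‖w‖ + ‖lam j‖ + κ / 2 * ‖τ‖) * ‖w‖ ≤ 1 * ‖w‖ := by
      gcongr
      linarith
    linarith

/-- Inside the region `‖w‖^l ≤ ‖x‖^(k+2)`, so the full map acts on the chart as a perturbation of
the model and `petal_step` applies. The condition `‖w‖^N < ‖x‖` survives since `(1 - κ |x^k| / 2)^N
≤ 1 - 2 |x^k|`. -/
theorem region_step {n r k l N σ : ℕ} {F Φ : (Fin n → ℂ) → (Fin n → ℂ)} {lam : Fin n → ℂ}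
    {P Q : Fin n → ℕ} {fib : Fin n → ℂ × ℂ → ℂ} (h : IsShadowed F lam r P Q fib k l Φ)
    (hk : k ≠ 0) (hσ : σ ≠ 0)
    (hhom : ∀ j (c : ℂ) (u : ℂ × ℂ), fib j (c * u.1, c * u.2) = c ^ k * fib j u)
    (hcont : ∀ j, Continuous (fib j)) {v : ℂ × ℂ} (hv : v.1 ≠ 0)
    (hP : ∑ j, P j * fib j v = -(1 / (k : ℂ))) {g : ℂ → ℂ} {C : ℂ} (hC : C ≠ 0)
    (hgc : ContinuousAt g 0) (hg0 : g 0 = C)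
    (hg : ∀ᶠ y in 𝓝 0, (v.2 / v.1 + y) * (∑ j, Q j * fib j (v.1, v.2 + v.1 * y) -
      ∑ j, P j * fib j (v.1, v.2 + v.1 * y)) = y ^ (σ + 1) * g y)
    (h_one : ∀ j : Fin n, j.val < r → ‖lam j‖ = 1) (h_lt : ∀ j : Fin n, r ≤ j.val → ‖lam j‖ < 1)
    {κ : ℝ} (hκ0 : 0 < κ) (hκ8 : κ ≤ 1 / 8)
    (hκ : ∀ j : Fin n, j.val < r → ∀ τ f : ℂ, ‖τ‖ ≤ κ → |τ.im| ≤ κ * τ.re →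
      ‖f - fib j v‖ ≤ κ → ‖1 + τ * f‖ ≤ 1 - κ * ‖τ‖)
    (hN0 : N ≠ 0) (hNκ : 4 ≤ N * (κ / 2)) (hl : N * (k + 2) ≤ l) :
    ∃ U ∈ 𝓝 (0 : Fin n → ℂ), ∀ᶠ ε in 𝓝[>] (0 : ℝ), ∀ z ∈ U,
      Φ z ∈ basinRegion P Q v k σ C κ N ε →
      Φ (F z) ∈ basinRegion P Q v k σ C κ N ε ∧
      (((chart P Q v (Φ z)).1 ^ k)⁻¹).re + 1 / 2 ≤ (((chart P Q v (Φ (F z))).1 ^ k)⁻¹).re := by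
  obtain ⟨U₁, hU₁, hfib⟩ := fiber_contraction h hhom hcont hv h_one h_lt hκ0 hκ hN0 hl
  obtain ⟨K, hK, hbase⟩ := h.base.exists_nonneg
  obtain ⟨η, hη, hpetal⟩ := petal_step hk hσ hC hκ0 hκ8
  set M := ‖v.1‖ + ‖v.2‖ with hM
  have hM0 : 0 ≤ M := by positivity
  have hv0 : 0 < ‖v.1‖ := norm_pos_iff.2 hv
  set G₁ : ℂ → ℂ := fun y => ∑ j, P j * fib j (v.1, v.2 + v.1 * y) with hG₁
  set G₂ : ℂ → ℂ := fun y => ∑ j, Q j * fib j (v.1, v.2 + v.1 * y) with hG₂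
  have hG₁c : ContinuousAt G₁ 0 := by
    refine Continuous.continuousAt (continuous_finsetSum _ fun j _ => ?_)
    have := hcont j
    fun_prop
  obtain ⟨ρ, ⟨⟨⟨⟨hρf, hρp⟩, hρ1⟩, hρN⟩, hρ2⟩, hρ0⟩ := (((((hfib.and
    (perturbed_step hk hG₁c (by simpa [hG₁] using hP) hgc hg0 hg
      (K * (M ^ (k + 2) + 1) / ‖v.1‖) hη)).and (eventually_const_mul_le 1 one_pos)).and
      (eventually_const_mul_le (N * (κ / 2)) one_pos)).and
      (eventually_const_mul_le 4 one_pos)).and self_mem_nhdsWithin).exists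
  have hρ0 : 0 < ρ := hρ0
  refine ⟨_, inter_mem hU₁ hbase.bound, ?_⟩
  filter_upwards [petal_small hk hσ hC κ hρ0, hpetal] with ε hsm hst z hz hreg
  obtain ⟨hp, hwN⟩ := hreg
  obtain ⟨hx, hy, hxρ, hyρ, hxy, hτρ, hτim, hτre⟩ := hsm _ hp
  have hcontr := hρf z hz.1 hx hxρ hyρ hτρ hτim hwN
  have hb : ‖resMono P Q (Φ (F z)) - (resMono P Q (Φ z) + shadowMap P Q fib (resMono P Q (Φ z)))‖ ≤
    K * ‖‖resMono P Q (Φ z)‖ ^ (k + 2) + ‖Φ z‖ ^ l‖ := hz.2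
  rw [Real.norm_of_nonneg (by positivity)] at hb
  set w := Φ z with hw
  set w' := Φ (F z) with hw'
  have hU := resMono_eq_of_chart hv hx
  have hUn := resMono_norm_le_of_chart hv hx (hyρ.trans (by linarith))
  have hch : chart P Q v w = ((chart P Q v w).1, (chart P Q v w).2) := rfl
  set x := (chart P Q v w).1
  set y := (chart P Q v w).2
  have hxn : 0 < ‖x‖ := norm_pos_iff.2 hx
  have hw1 : ‖w‖ ≤ 1 := by
    refine (lt_of_pow_lt_pow_left₀ N zero_le_one ?_).le
    rw [one_pow]
    linarith
  have hwl : ‖w‖ ^ l ≤ ‖x‖ ^ (k + 2) := by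
    calc ‖w‖ ^ l ≤ ‖w‖ ^ (N * (k + 2)) := pow_le_pow_of_le_one (norm_nonneg _) hw1 hl
      _ = (‖w‖ ^ N) ^ (k + 2) := pow_mul _ _ _
      _ ≤ ‖x‖ ^ (k + 2) := by gcongr
  have hb2 : ‖resMono P Q w' - (resMono P Q w + shadowMap P Q fib (resMono P Q w))‖ ≤
      K * (M ^ (k + 2) + 1) * ‖x‖ ^ (k + 2) := by
    refine hb.trans ?_
    calc K * (‖resMono P Q w‖ ^ (k + 2) + ‖w‖ ^ l)
        ≤ K * ((M * ‖x‖) ^ (k + 2) + ‖x‖ ^ (k + 2)) := by gcongr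
      _ = _ := by rw [mul_pow]; ring
  have hsum : ∀ L : Fin n → ℕ, ∑ j, L j * fib j (resMono P Q w) =
      x ^ k * ∑ j, L j * fib j (v.1, v.2 + v.1 * y) := by
    intro L
    rw [Finset.mul_sum]
    refine Finset.sum_congr rfl fun j _ => ?_
    rw [hU, hhom j x (v.1, v.2 + v.1 * y)]
    ring
  have hdiv : ∀ a b c : ℂ, ‖a - b‖ ≤ K * (M ^ (k + 2) + 1) * ‖x‖ ^ (k + 2) → b = v.1 * c →
      ‖a / v.1 - c‖ ≤ K * (M ^ (k + 2) + 1) / ‖v.1‖ * ‖x‖ ^ (k + 2) := by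
    intro a b c hab hbc
    have : a / v.1 - c = (a - b) / v.1 := by
      rw [hbc]
      field_simp
    rw [this, norm_div, div_mul_eq_mul_div]
    gcongr
  have e1 := hdiv _ _ (x * (1 + x ^ k * G₁ y)) ((norm_fst_le _).trans hb2) (by
    simp only [shadowMap, Prod.fst_add, hsum]
    rw [hU]
    ring)
  have e2 := hdiv _ _ (x * (v.2 / v.1 + y) * (1 + x ^ k * G₂ y)) ((norm_snd_le _).trans hb2) (by
    simp only [shadowMap, Prod.snd_add, hsum]
    rw [hU]
    field_simp
    ring)
  obtain ⟨η₁, η₂, hη₁, hη₂, hx', hy'⟩ := hρp x y _ _ hx hy hxρ hyρ hxy hτρ e1 e2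
  obtain ⟨s1, s2, s3⟩ := hst x y η₁ η₂ hη₁ hη₂ hp
  have hch' : chart P Q v w' = (x * (1 + x ^ k * (-(1 / (k : ℂ)) + η₁)),
      y * (1 + x ^ k * y ^ σ * (C + η₂))) := by
    rw [← hy', ← hx']
    simp only [chart, resMono]
    rw [div_div_div_cancel_right₀ hv]
  refine ⟨⟨by rwa [hch'], ?_⟩, by rw [hch']; exact s2⟩
  rw [hch']
  refine lt_of_lt_of_le ?_ s3
  have hτ0 := norm_nonneg (x ^ k)
  have hκτ : κ / 2 * ‖x ^ k‖ ≤ 1 := by nlinarith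
  have hNτ : N * (κ / 2) * ‖x ^ k‖ ≤ 1 :=
    (mul_le_mul_of_nonneg_left hτρ (by positivity)).trans hρN
  calc ‖w'‖ ^ N ≤ (‖w‖ * (1 - κ / 2 * ‖x ^ k‖)) ^ N := by gcongr
    _ = ‖w‖ ^ N * (1 - κ / 2 * ‖x ^ k‖) ^ N := mul_pow _ _ _
    _ ≤ ‖w‖ ^ N * (1 - 2 * ‖x ^ k‖) := by
      gcongr
      exact one_sub_pow_le hNκ hτ0 hNτ hκτ (by positivity)
    _ < ‖x‖ * (1 - 2 * ‖x ^ k‖) := by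
      gcongr
      linarith

/-! ### Openness of the region and its accumulation at the origin. -/

theorem isOpen_petal {k σ : ℕ} (hk : k ≠ 0) (hσ : σ ≠ 0) {C : ℂ} (hC : C ≠ 0) {κ ε : ℝ}
    (hε : 0 < ε) : IsOpen (petal k σ C κ ε) := by
  rw [isOpen_iff_mem_nhds]
  intro p hp
  have hx := petal_fst_ne_zero hε hk hp
  have hy := petal_snd_ne_zero hp
  have hσC : (σ : ℂ) ≠ 0 := by exact_mod_cast hσ
  have c1 : ContinuousAt (fun p : ℂ × ℂ => (p.1 ^ k)⁻¹) p :=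
    (continuousAt_fst.pow k).inv₀ (pow_ne_zero k hx)
  have c2 : ContinuousAt (fun p : ℂ × ℂ => -(σ * C * p.2 ^ σ)⁻¹) p :=
    ((continuousAt_const.mul (continuousAt_snd.pow σ)).inv₀
      (mul_ne_zero (mul_ne_zero hσC hC) (pow_ne_zero σ hy))).neg
  have cre := Complex.continuous_re.continuousAt.comp c1
  have cim := Complex.continuous_im.continuousAt.comp c1
  have cre2 := Complex.continuous_re.continuousAt.comp c2
  filter_upwards [continuousAt_const.eventually_lt cre hp.1,
    cim.abs.eventually_lt (continuousAt_const.mul cre) hp.2.1,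
    continuousAt_const.eventually_lt cre2 hp.2.2.1,
    continuousAt_fst.norm.eventually_lt (continuousAt_const.mul (continuousAt_snd.norm.pow (σ + 1)))
      hp.2.2.2] with q h1 h2 h3 h4
  exact ⟨h1, h2, h3, h4⟩

theorem isOpen_basinRegion {n : ℕ} (P Q : Fin n → ℕ) (v : ℂ × ℂ) {k σ : ℕ} (hk : k ≠ 0)
    (hσ : σ ≠ 0) {C : ℂ} (hC : C ≠ 0) (κ : ℝ) (N : ℕ) {ε : ℝ} (hε : 0 < ε) :
    IsOpen (basinRegion P Q v k σ C κ N ε) := by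
  rw [isOpen_iff_mem_nhds]
  intro w hw
  have hx := petal_fst_ne_zero hε hk hw.1
  have hP : mono w P ≠ 0 := by
    intro h0
    exact hx (by simp [chart, h0])
  have cP : ContinuousAt (fun w => mono w P) w := (analyticAt_mono P w).continuousAt
  have cQ : ContinuousAt (fun w => mono w Q) w := (analyticAt_mono Q w).continuousAt
  have c : ContinuousAt (chart P Q v) w :=
    (cP.div_const v.1).prodMk ((cQ.div cP hP).sub continuousAt_const)
  filter_upwards [c ((isOpen_petal hk hσ hC hε).mem_nhds hw.1),
    (continuousAt_id.norm.pow N).eventually_lt (continuousAt_fst.comp c).norm hw.2] with q h1 h2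
  exact ⟨h1, h2⟩

/-- Cramer's rule on a nonzero `2 × 2` minor of the matrix with rows `P`, `Q`. The dual vectors
allow the two resonant monomials to be prescribed independently. -/
theorem exists_dual {n : ℕ} {P Q : Fin n → ℕ}
    (h : LinearIndependent ℚ ![fun i => (P i : ℚ), fun i => (Q i : ℚ)]) :
    ∃ A B : Fin n → ℂ, ∑ i, P i * A i = 1 ∧ ∑ i, Q i * A i = 0 ∧
      ∑ i, P i * B i = 0 ∧ ∑ i, Q i * B i = 1 := by
  have hminor : ∃ i j, P i * Q j ≠ P j * Q i := by
    by_contra! hcon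
    have hP : ∃ i, P i ≠ 0 := by
      by_contra! h0
      exact one_ne_zero (linInd_nat h (s := 1) (t := 0) (by simp [h0])).1
    obtain ⟨i, hi⟩ := hP
    have := linInd_nat h (s := Q i) (t := -P i) fun x => by
      have : (P i * Q x : ℚ) = P x * Q i := by exact_mod_cast hcon i x
      linarith
    exact hi (by exact_mod_cast neg_eq_zero.1 this.2)
  obtain ⟨i, j, hij⟩ := hminor
  set D : ℂ := P i * Q j - P j * Q i with hD
  have hD0 : D ≠ 0 := sub_ne_zero.2 (by exact_mod_cast hij)
  have hsum : ∀ (L : Fin n → ℕ) (a b : ℂ),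
      ∑ x, (L x : ℂ) * ((a * (if x = i then 1 else 0) + b * (if x = j then 1 else 0)) / D) =
      (a * L i + b * L j) / D := by
    intro L a b
    have : ∀ x, (L x : ℂ) * ((a * (if x = i then 1 else 0) + b * (if x = j then 1 else 0)) / D) =
        (if x = i then a * L x / D else 0) + (if x = j then b * L x / D else 0) := by
      intro x
      split_ifs <;> ring
    simp only [this, Finset.sum_add_distrib, Finset.sum_ite_eq', Finset.mem_univ, if_true]
    ring
  refine ⟨fun x => (Q j * (if x = i then 1 else 0) + -Q i * (if x = j then 1 else 0)) / D,
    fun x => (-P j * (if x = i then 1 else 0) + P i * (if x = j then 1 else 0)) / D, ?_, ?_, ?_, ?_⟩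
  all_goals
    rw [hsum]
    field_simp
    try rw [hD]
    try ring

theorem exists_slow_point {σ : ℕ} (hσ : σ ≠ 0) {C : ℂ} (hC : C ≠ 0) (u₀ : ℂ) (S : ℝ) :
    ∃ y : ℂ, y ≠ 0 ∧ u₀ + y ≠ 0 ∧ S < (-(σ * C * y ^ σ)⁻¹).re := by
  have hσC : (σ : ℂ) ≠ 0 := by exact_mod_cast hσ
  -- The point `y` is a `σ`-th root making `-1 / (σ C y^σ)` equal to `T`. Only one value of `T`
  -- could allow `y = -u₀`, so one of two candidates is good.
  obtain ⟨T, hT0, hTS, hT⟩ : ∃ T : ℝ, 0 < T ∧ S < T ∧ -(σ * C * T)⁻¹ ≠ (-u₀) ^ σ := by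
    by_contra! hcon
    have h1 := hcon (|S| + 1) (by positivity) (by linarith [le_abs_self S])
    have h2 := hcon (|S| + 2) (by positivity) (by linarith [le_abs_self S])
    rw [← h2, neg_inj, inv_inj] at h1
    have h3 := mul_left_cancel₀ (mul_ne_zero hσC hC) h1
    have h4 : |S| + 1 = |S| + 2 := by exact_mod_cast h3
    linarith
  obtain ⟨y, hy⟩ := IsAlgClosed.exists_pow_nat_eq (-(σ * C * T)⁻¹ : ℂ) (Nat.pos_of_ne_zero hσ)
  have hTC : (T : ℂ) ≠ 0 := by exact_mod_cast hT0.ne'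
  refine ⟨y, ?_, ?_, ?_⟩
  · rintro rfl
    rw [zero_pow hσ] at hy
    exact (neg_ne_zero.2 (inv_ne_zero (mul_ne_zero (mul_ne_zero hσC hC) hTC))) hy.symm
  · intro h0
    rw [← eq_neg_of_add_eq_zero_right h0, hy] at hT
    exact hT rfl
  · have : -(σ * C * y ^ σ)⁻¹ = (T : ℂ) := by
      rw [hy]
      field_simp
    rw [this, Complex.ofReal_re]
    exact hTS

/-- Along the curve `w_j(t) = exp(A_j a + B_j b - α_j t)`, `j ≤ r`, the chart is exactly `(e^(-t),
y)` with `y` fixed, while `N α_j > 1` gives `‖w‖^N < e^(-t)` for large `t`. -/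
theorem frequently_mem_basinRegion {n r k σ N : ℕ} {P Q : Fin n → ℕ}
    (hPQ : LinearIndependent ℚ ![fun i => (P i : ℚ), fun i => (Q i : ℚ)])
    (hs : ∀ j : Fin n, r ≤ j.val → P j = 0 ∧ Q j = 0) {v : ℂ × ℂ} (hv : v.1 ≠ 0)
    (hk : k ≠ 0) (hσ : σ ≠ 0) {C : ℂ} (hC : C ≠ 0) {κ ε : ℝ} (hκ : 0 < κ) (hε : 0 < ε)
    {α : Fin n → ℝ} (hPα : ∑ j, P j * α j = 1) (hQα : ∑ j, Q j * α j = 1) (hN : N ≠ 0)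
    (hα : ∀ j : Fin n, j.val < r → 1 < N * α j) :
    ∃ᶠ w in 𝓝 (0 : Fin n → ℂ), w ∈ basinRegion P Q v k σ C κ N ε := by
  obtain ⟨A, B, hPA, hQA, hPB, hQB⟩ := exists_dual hPQ
  obtain ⟨y, hy, huy, hyS⟩ := exists_slow_point hσ hC (v.2 / v.1) ε⁻¹
  set a := Complex.log v.1 with ha
  set b := Complex.log (v.1 * (v.2 / v.1 + y)) with hb
  have hea : Complex.exp a = v.1 := Complex.exp_log hv
  have heb : Complex.exp b = v.1 * (v.2 / v.1 + y) := Complex.exp_log (mul_ne_zero hv huy)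
  set w : ℝ → Fin n → ℂ := fun t j =>
    if j.val < r then Complex.exp (A j * a + B j * b - α j * t) else 0 with hw
  have hNR : (0 : ℝ) < N := by exact_mod_cast Nat.pos_of_ne_zero hN
  have hmono : ∀ L : Fin n → ℕ, (∀ j : Fin n, r ≤ j.val → L j = 0) → ∀ t, mono (w t) L =
      Complex.exp ((∑ j, L j * A j) * a + (∑ j, L j * B j) * b -
        ((∑ j, L j * α j : ℝ) : ℂ) * t) := by
    intro L hL t
    have : ((∑ j, L j * A j) * a + (∑ j, L j * B j) * b - ((∑ j, L j * α j : ℝ) : ℂ) * t) =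
        ∑ j, (L j : ℂ) * (A j * a + B j * b - α j * t) := by
      push_cast
      rw [Finset.sum_mul, Finset.sum_mul, Finset.sum_mul, ← Finset.sum_add_distrib,
        ← Finset.sum_sub_distrib]
      exact Finset.sum_congr rfl fun j _ => by ring
    rw [this, Complex.exp_sum, mono]
    refine Finset.prod_congr rfl fun j _ => ?_
    by_cases hj : j.val < r
    · simp only [hw, hj, if_true, ← Complex.exp_nat_mul]
    · simp [hL j (not_lt.1 hj)]
  have hwP : ∀ t : ℝ, mono (w t) P = v.1 * Complex.exp (-t) := by
    intro t
    rw [hmono P (fun j hj => (hs j hj).1), hPA, hPB, hPα, ← hea, ← Complex.exp_add]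
    congr 1
    push_cast
    ring
  have hwQ : ∀ t : ℝ, mono (w t) Q = v.1 * (v.2 / v.1 + y) * Complex.exp (-t) := by
    intro t
    rw [hmono Q (fun j hj => (hs j hj).2), hQA, hQB, hQα, ← heb, ← Complex.exp_add]
    congr 1
    push_cast
    ring
  have hchart : ∀ t : ℝ, chart P Q v (w t) = (((Real.exp (-t) : ℝ) : ℂ), y) := by
    intro t
    have he := Complex.exp_ne_zero (-t)
    simp only [chart, hwP, hwQ]
    ext
    · simp only
      push_cast
      field_simp
    · simp only
      field_simp
      ring
  have hwn : ∀ᶠ t : ℝ in atTop, ‖w t‖ < Real.exp (-(t / N)) := by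
    have : ∀ᶠ t : ℝ in atTop, ∀ j, ‖w t j‖ < Real.exp (-(t / N)) := by
      rw [eventually_all]
      intro j
      by_cases hj : j.val < r
      · have hpos : 0 < α j - 1 / N := by
          rw [sub_pos, div_lt_iff₀ hNR, mul_comm]
          exact hα j hj
        filter_upwards [(tendsto_id.const_mul_atTop hpos).eventually_gt_atTop
          (A j * a + B j * b).re] with t ht
        simp only [hw, hj, if_true, Complex.norm_exp, Complex.sub_re, Real.exp_lt_exp]
        have h1 : (α j * t : ℂ).re = α j * t := by rw [← Complex.ofReal_mul, Complex.ofReal_re]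
        rw [h1]
        simp only [id] at ht
        have h2 : (α j - 1 / N) * t = α j * t - t / N := by ring
        linarith
      · refine Eventually.of_forall fun t => ?_
        simp [hw, hj, Real.exp_pos]
    filter_upwards [this] with t ht
    exact (pi_norm_lt_iff (Real.exp_pos _)).2 ht
  have hwt : Tendsto w atTop (𝓝 0) := by
    refine squeeze_zero_norm' (hwn.mono fun t ht => ht.le) ?_
    exact Real.tendsto_exp_neg_atTop_nhds_zero.comp (tendsto_id.atTop_div_const hNR)
  refine hwt.frequently (Eventually.frequently ?_)
  have hk1 : (0 : ℝ) < k := by exact_mod_cast Nat.pos_of_ne_zero hk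
  have e1 : ∀ᶠ t : ℝ in atTop, ε⁻¹ < Real.exp (k * t) :=
    (Real.tendsto_exp_atTop.comp (tendsto_id.const_mul_atTop hk1)).eventually_gt_atTop _
  have e2 : ∀ᶠ t : ℝ in atTop, Real.exp (-t) < ε * ‖y‖ ^ (σ + 1) :=
    Real.tendsto_exp_neg_atTop_nhds_zero.eventually_lt_const
      (mul_pos hε (pow_pos (norm_pos_iff.2 hy) _))
  filter_upwards [hwn, e1, e2] with t h1 h2 h3
  have hpow : (((Real.exp (-t) : ℝ) : ℂ) ^ k)⁻¹ = ((Real.exp (k * t) : ℝ) : ℂ) := by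
    rw [← Complex.ofReal_pow, ← Complex.ofReal_inv, ← Real.exp_nat_mul, ← Real.exp_neg]
    congr 2
    ring
  have hnorm : ‖((Real.exp (-t) : ℝ) : ℂ)‖ = Real.exp (-t) := by
    rw [Complex.norm_real, Real.norm_of_nonneg (Real.exp_pos _).le]
  refine ⟨?_, ?_⟩
  · rw [hchart]
    refine ⟨?_, ?_, hyS, ?_⟩
    · simp only [hpow, Complex.ofReal_re]
      exact h2
    · simp only [hpow, Complex.ofReal_re, Complex.ofReal_im, abs_zero]
      exact mul_pos hκ (Real.exp_pos _)
    · simp only [hnorm]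
      exact h3
  · rw [hchart]
    simp only [hnorm]
    calc ‖w t‖ ^ N < Real.exp (-(t / N)) ^ N := by gcongr
      _ = Real.exp (-t) := by
        rw [← Real.exp_nat_mul]
        congr 1
        field_simp

/-! ### Construction of the basin. -/

theorem exists_basin {n r k σ : ℕ} {F : (Fin n → ℂ) → (Fin n → ℂ)} (hF0 : F 0 = 0)
    (hF : AnalyticAt ℂ F 0) {lam : Fin n → ℂ} {P Q : Fin n → ℕ}
    (hPQ : LinearIndependent ℚ ![fun i => (P i : ℚ), fun i => (Q i : ℚ)])
    (hs : ∀ j : Fin n, r ≤ j.val → P j = 0 ∧ Q j = 0)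
    {fib : Fin n → ℂ × ℂ → ℂ}
    (hshadow : ∀ l, ∃ l' Φ, l ≤ l' ∧ IsShadowed F lam r P Q fib k l' Φ)
    (hk : k ≠ 0) (hσ : σ ≠ 0)
    (hhom : ∀ j (c : ℂ) (u : ℂ × ℂ), fib j (c * u.1, c * u.2) = c ^ k * fib j u)
    (hcont : ∀ j, Continuous (fib j)) {v : ℂ × ℂ} (hv : v.1 ≠ 0)
    (hPv : ∑ j, P j * fib j v = -(1 / (k : ℂ))) (hQv : ∑ j, Q j * fib j v = -(1 / (k : ℂ)))
    {g : ℂ → ℂ} (hgc : ContinuousAt g 0) (hg0 : g 0 ≠ 0)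
    (hg : ∀ᶠ y in 𝓝 0, (v.2 / v.1 + y) * (∑ j, Q j * fib j (v.1, v.2 + v.1 * y) -
      ∑ j, P j * fib j (v.1, v.2 + v.1 * y)) = y ^ (σ + 1) * g y)
    (h_one : ∀ j : Fin n, j.val < r → ‖lam j‖ = 1) (h_lt : ∀ j : Fin n, r ≤ j.val → ‖lam j‖ < 1)
    (hatt : ∀ j : Fin n, j.val < r → (fib j v).re < 0) :
    ∀ W ∈ 𝓝 (0 : Fin n → ℂ), ∃ V ⊆ W, IsBasinAtBoundary F V := by
  intro W hW
  have hkC : (k : ℂ) ≠ 0 := by exact_mod_cast hk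
  have hk1 : (0 : ℝ) < k := by exact_mod_cast Nat.pos_of_ne_zero hk
  have hP0 : P ≠ 0 := by
    rintro rfl
    exact one_ne_zero (linInd_nat hPQ (s := 1) (t := 0) (by simp)).1
  have hκe : ∀ᶠ κ in 𝓝[>] (0 : ℝ), ∀ j : Fin n, j.val < r → ∀ τ f : ℂ, ‖τ‖ ≤ κ →
      |τ.im| ≤ κ * τ.re → ‖f - fib j v‖ ≤ κ → ‖1 + τ * f‖ ≤ 1 - κ * ‖τ‖ := by
    rw [eventually_all]
    intro j
    by_cases hj : j.val < r
    · filter_upwards [contraction_eventually (hatt j hj)] with κ h _ using h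
    · exact Eventually.of_forall fun _ h => absurd h hj
  obtain ⟨κ, ⟨hκ, hκ8⟩, hκ0⟩ := ((hκe.and (eventually_const_mul_le 1
    (show (0 : ℝ) < 1 / 8 by norm_num))).and self_mem_nhdsWithin).exists
  have hκ0 : 0 < κ := hκ0
  rw [one_mul] at hκ8
  -- Decay exponents of the coordinates relative to `x`; the two normalizations at `v` become `∑ P_j
  -- α_j = ∑ Q_j α_j = 1`.
  set α : Fin n → ℝ := fun j => -k * (fib j v).re with hα
  have hαsum : ∀ L : Fin n → ℕ, ∑ j, L j * fib j v = -(1 / (k : ℂ)) → ∑ j, L j * α j = 1 := by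
    intro L hL
    have h1 : ∑ j, (L j : ℝ) * (fib j v).re = -(1 / k) := by
      have := congrArg Complex.re hL
      rw [Complex.re_sum] at this
      have hre : (-(1 / (k : ℂ))).re = -(1 / k) := by
        have : (-(1 / (k : ℂ))) = ((-(1 / k) : ℝ) : ℂ) := by push_cast; rfl
        rw [this, Complex.ofReal_re]
      rw [hre] at this
      rw [← this]
      exact Finset.sum_congr rfl fun j _ => by simp
    have h2 : ∑ j, (L j : ℝ) * α j = -k * ∑ j, (L j : ℝ) * (fib j v).re := by
      rw [Finset.mul_sum]
      exact Finset.sum_congr rfl fun j _ => by rw [hα]; ring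
    rw [h2, h1]
    field_simp
  have hNe : ∀ᶠ N : ℕ in atTop, ∀ j : Fin n, j.val < r → 1 < N * α j := by
    rw [eventually_all]
    intro j
    by_cases hj : j.val < r
    · have hpos : 0 < α j := by
        have := mul_pos hk1 (neg_pos.2 (hatt j hj))
        simp only [hα]
        linarith
      filter_upwards [(tendsto_natCast_atTop_atTop.atTop_mul_const hpos).eventually_gt_atTop 1]
        with N hN _ using hN
    · exact Eventually.of_forall fun _ h => absurd h hj
  obtain ⟨N, ⟨hNα, hNκ⟩, hN0⟩ := ((hNe.and
    ((tendsto_natCast_atTop_atTop.atTop_mul_const (half_pos hκ0)).eventually_ge_atTop 4)).and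
    (eventually_ne_atTop 0)).exists
  -- The required order of normalization depends on `N`, hence on `κ` and the fiber terms at `v`;
  -- thus `hshadow` must be available for every order.
  obtain ⟨l, Φ, hl, hΦ⟩ := hshadow (N * (k + 2))
  obtain ⟨U, hU, hstep⟩ := region_step hΦ hk hσ hhom hcont hv hPv hg0 hgc rfl hg h_one h_lt hκ0 hκ8
    hκ hN0 hNκ hl
  obtain ⟨B, hB, hbound⟩ := hΦ.bound.exists_nonneg
  have hFt : Tendsto F (𝓝 0) (𝓝 0) := by simpa [ContinuousAt, hF0] using hF.continuousAt
  obtain ⟨d₀, hd₀, hgood⟩ := Metric.eventually_nhds_iff.1 (((show ∀ᶠ z in 𝓝 0, z ∈ W from hW).and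
    (show ∀ᶠ z in 𝓝 0, z ∈ U from hU)).and (hΦ.continuous.and hbound.bound))
  obtain ⟨d₁, hd₁, hFd⟩ := Metric.eventually_nhds_iff.1
    ((hFt.eventually (Metric.ball_mem_nhds 0 hd₀)).and (Metric.ball_mem_nhds 0 hd₀))
  simp only [dist_zero_right] at hgood hFd
  -- With `‖x‖` below this value, `‖w‖^N < ‖x‖` and `‖z‖ ≤ B ‖Φ z‖` return images to the ball of
  -- radius `d₁`, so no orbit leaves the domain of the estimates.
  have hρ : 0 < (d₁ / (B + 1)) ^ N := by positivity
  obtain ⟨ε, ⟨hsm, hst⟩, hε⟩ := (((petal_small hk hσ hg0 κ hρ).and hstep).and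
    self_mem_nhdsWithin).exists
  have hε : 0 < ε := hε
  set R := basinRegion P Q v k σ (g 0) κ N ε with hR
  have hRopen : IsOpen R := isOpen_basinRegion P Q v hk hσ hg0 κ N hε
  have hRsmall : ∀ w ∈ R, B * ‖w‖ < d₁ := by
    intro w hw
    have h1 := (hsm _ hw.1).2.2.1
    have h2 : ‖w‖ < d₁ / (B + 1) := lt_of_pow_lt_pow_left₀ N (by positivity) (hw.2.trans_le h1)
    rw [lt_div_iff₀ (by positivity)] at h2
    have := norm_nonneg w
    linarith
  set V : Set (Fin n → ℂ) := {z | ‖z‖ < d₁ ∧ Φ z ∈ R} with hV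
  have hVd : ∀ z ∈ V, ‖z‖ < d₀ := fun z hz => (hFd hz.1).2
  have hmaps : Set.MapsTo F V V := by
    intro z hz
    have h1 := (hFd hz.1).1
    have h2 := (hst z (hgood (hVd z hz)).1.2 hz.2).1
    refine ⟨?_, h2⟩
    exact ((hgood h1).2.2).trans_lt (hRsmall _ h2)
  have hcl : (0 : Fin n → ℂ) ∈ closure V := by
    rw [mem_closure_iff_frequently]
    have h1 := (frequently_mem_basinRegion hPQ hs hv hk hσ hg0 hκ0 hε (hαsum P hPv) (hαsum Q hQv)
      hN0 hNα).filter_mono hΦ.le_map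
    rw [frequently_map] at h1
    refine (h1.and_eventually (Metric.ball_mem_nhds (0 : Fin n → ℂ) hd₁)).mono fun z hz => ?_
    exact ⟨mem_ball_zero_iff.1 hz.2, hz.1⟩
  have h0V : (0 : Fin n → ℂ) ∉ V := by
    intro h0
    have h1 := petal_fst_ne_zero hε hk h0.2.1
    rw [hΦ.map_zero] at h1
    exact h1 (by simp [chart, mono_zero hP0])
  refine ⟨V, fun z hz => (hgood (hVd z hz)).1.1, ?_, closure_nonempty_iff.1 ⟨0, hcl⟩,
    ⟨hcl, fun h => h0V (interior_subset h)⟩, hmaps, ?_⟩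
  · rw [isOpen_iff_mem_nhds]
    intro z hz
    have hc : ContinuousAt Φ z := (hgood (hVd z hz)).2.1
    filter_upwards [hc (hRopen.mem_nhds hz.2),
      Metric.isOpen_ball.mem_nhds (mem_ball_zero_iff.2 hz.1)] with q h1 h2
    exact ⟨mem_ball_zero_iff.1 h2, h1⟩
  · intro z hz
    have hmem : ∀ m, F^[m] z ∈ V := fun m => (hmaps.iterate m) hz
    set ω : ℕ → ℝ := fun m => (((chart P Q v (Φ (F^[m] z))).1 ^ k)⁻¹).re with hω
    have hωm : ∀ m : ℕ, ω 0 + m * (1 / 2) ≤ ω m := by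
      intro m
      induction m with
      | zero => simp
      | succ m ih =>
        have h1 := (hst _ (hgood (hVd _ (hmem m))).1.2 (hmem m).2).2
        have h2 : ω (m + 1) = (((chart P Q v (Φ (F (F^[m] z)))).1 ^ k)⁻¹).re := by
          simp only [hω, Function.iterate_succ_apply']
        rw [h2]
        push_cast
        linarith
    have hωt : Tendsto ω atTop atTop :=
      tendsto_atTop_mono hωm (tendsto_atTop_add_const_left _ _
        (tendsto_natCast_atTop_atTop.atTop_mul_const (by norm_num)))
    have hΦt : Tendsto (fun m => Φ (F^[m] z)) atTop (𝓝 0) := by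
      rw [Metric.tendsto_atTop']
      intro e he
      have h1 := (tendsto_inv_atTop_zero.comp hωt).eventually_lt_const
        (show 0 < e ^ (N * k) by positivity)
      obtain ⟨M, hM⟩ := eventually_atTop.1 (h1.and (hωt.eventually_gt_atTop 0))
      refine ⟨M, fun m hm => ?_⟩
      obtain ⟨h2, h3⟩ := hM m hm.le
      rw [dist_zero_right]
      refine lt_of_pow_lt_pow_left₀ (N * k) he.le ?_
      have hx := petal_fst_ne_zero hε hk (hmem m).2.1
      have h4 : ω m ≤ (‖(chart P Q v (Φ (F^[m] z))).1‖ ^ k)⁻¹ := by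
        rw [← norm_pow, ← norm_inv]
        exact (le_abs_self _).trans (Complex.abs_re_le_norm _)
      have h5 : ‖(chart P Q v (Φ (F^[m] z))).1‖ ^ k ≤ (ω m)⁻¹ := by
        rw [le_inv_comm₀ (by positivity) h3]
        exact h4
      calc ‖Φ (F^[m] z)‖ ^ (N * k) = (‖Φ (F^[m] z)‖ ^ N) ^ k := pow_mul _ _ _
        _ ≤ ‖(chart P Q v (Φ (F^[m] z))).1‖ ^ k := by
          gcongr
          exact (hmem m).2.2.le
        _ ≤ (ω m)⁻¹ := h5
        _ < e ^ (N * k) := h2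
    refine squeeze_zero_norm (fun m => (hgood (hVd _ (hmem m))).2.2) ?_
    simpa using hΦt.norm.const_mul B

/-- Homogeneity converts the factorization of `g₂` at `u₀ = v₂ / v₁` into the equation for `y` along
`(v₁, v₂ + v₁ y)`, with `C = v₁^k h(u₀)`. -/
theorem exists_basin_of_irregularAt {n r k : ℕ} {F : (Fin n → ℂ) → (Fin n → ℂ)} (hF0 : F 0 = 0)
    (hF : AnalyticAt ℂ F 0) {lam : Fin n → ℂ} {P Q : Fin n → ℕ}
    (hPQ : LinearIndependent ℚ ![fun i => (P i : ℚ), fun i => (Q i : ℚ)])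
    (hs : ∀ j : Fin n, r ≤ j.val → P j = 0 ∧ Q j = 0)
    {fib : Fin n → ℂ × ℂ → ℂ}
    (hshadow : ∀ l, ∃ l' Φ, l ≤ l' ∧ IsShadowed F lam r P Q fib k l' Φ) (hk : k ≠ 0)
    (hhom : ∀ j (c : ℂ) (u : ℂ × ℂ), fib j (c * u.1, c * u.2) = c ^ k * fib j u)
    (hana : ∀ j u, AnalyticAt ℂ (fib j) u) {v : ℂ × ℂ} (hv : v.1 ≠ 0)
    (hdir : IsNormalizedDirection (shadowMap P Q fib) k v)
    (hirr : IsIrregularAt (shadowMap P Q fib) (v.2 / v.1))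
    (h_one : ∀ j : Fin n, j.val < r → ‖lam j‖ = 1) (h_lt : ∀ j : Fin n, r ≤ j.val → ‖lam j‖ < 1)
    (hatt : ∀ j : Fin n, j.val < r → (fib j v).re < 0) :
    ∀ W ∈ 𝓝 (0 : Fin n → ℂ), ∃ V ⊆ W, IsBasinAtBoundary F V := by
  have hcont : ∀ j, Continuous (fib j) := fun j =>
    continuous_iff_continuousAt.2 fun u => (hana j u).continuousAt
  set u₀ := v.2 / v.1 with hu₀
  have hv2 : v.2 = v.1 * u₀ := by rw [hu₀]; field_simp
  set D : ℂ → ℂ := fun u => (shadowMap P Q fib (1, u)).2 - u * (shadowMap P Q fib (1, u)).1 with hD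
  have hDan : AnalyticAt ℂ D u₀ := by
    have h1 : ∀ j, AnalyticAt ℂ (fun u : ℂ => fib j (1, u)) u₀ := fun j =>
      (hana j (1, u₀)).comp (analyticAt_const.prod analyticAt_id)
    have h2 : ∀ L : Fin n → ℕ, AnalyticAt ℂ (fun u : ℂ => ∑ j, (L j : ℂ) * fib j (1, u)) u₀ :=
      fun L => Finset.analyticAt_fun_sum _ fun j _ => analyticAt_const.mul (h1 j)
    exact (analyticAt_id.mul (h2 Q)).sub (analyticAt_id.mul (analyticAt_const.mul (h2 P)))
  obtain ⟨m, hm⟩ := ENat.ne_top_iff_exists.1 hirr.1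
  obtain ⟨h, hha, hh0, hhe⟩ := hDan.analyticOrderAt_eq_natCast.1 hm.symm
  -- As `μ₁ ≥ 0`, irregularity gives `μ₂ ≥ 2`, so the exponent `σ = μ₂ - 1` is positive.
  have hm2 : 2 ≤ m := by
    have h1 := hirr.2
    rw [← hm] at h1
    have h2 : (1 : ℕ∞) < m := lt_of_le_of_lt le_add_self h1
    exact_mod_cast h2
  obtain ⟨σ, rfl⟩ : ∃ σ, m = σ + 1 := ⟨m - 1, by omega⟩
  have hσ : σ ≠ 0 := by omega
  have hsum : ∀ (L : Fin n → ℕ) (y : ℂ), ∑ j, L j * fib j (v.1, v.2 + v.1 * y) =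
      v.1 ^ k * ∑ j, L j * fib j (1, u₀ + y) := by
    intro L y
    rw [Finset.mul_sum]
    refine Finset.sum_congr rfl fun j _ => ?_
    have := hhom j v.1 (1, u₀ + y)
    simp only [mul_one, mul_add, ← hv2] at this
    rw [this]
    ring
  have ht : Tendsto (fun y : ℂ => u₀ + y) (𝓝 0) (𝓝 u₀) := by
    simpa using! (continuous_const.add continuous_id : Continuous fun y : ℂ => u₀ + y).tendsto 0
  have hg : ∀ᶠ y in 𝓝 (0 : ℂ), (u₀ + y) * (∑ j, Q j * fib j (v.1, v.2 + v.1 * y) -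
      ∑ j, P j * fib j (v.1, v.2 + v.1 * y)) = y ^ (σ + 1) * (v.1 ^ k * h (u₀ + y)) := by
    filter_upwards [ht.eventually hhe] with y hy
    simp only [hD, shadowMap, add_sub_cancel_left, smul_eq_mul, one_mul] at hy
    rw [hsum, hsum]
    linear_combination v.1 ^ k * hy
  have hgc : ContinuousAt (fun y => v.1 ^ k * h (u₀ + y)) 0 := by
    refine continuousAt_const.mul ?_
    have h1 : ContinuousAt h (u₀ + 0) := by rw [add_zero]; exact hha.continuousAt
    exact h1.comp (f := fun y : ℂ => u₀ + y) (continuousAt_const.add continuousAt_id)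
  have hg0 : v.1 ^ k * h (u₀ + 0) ≠ 0 := by
    rw [add_zero]
    exact mul_ne_zero (pow_ne_zero k hv) hh0
  have hPv : ∑ j, P j * fib j v = -(1 / (k : ℂ)) := by
    have h1 := congrArg Prod.fst hdir.2
    simp only [shadowMap, Prod.smul_fst, smul_eq_mul] at h1
    exact mul_left_cancel₀ hv (by rw [h1, mul_comm])
  have hQv : ∑ j, Q j * fib j v = -(1 / (k : ℂ)) := by
    -- When `v₂ = 0` the second component of the eigenvector equation is empty. Here `u₀ = 0`, and
    -- dividing `y G(y) = O(y^(σ+1))` by `y` shows `G(0) = 0`: the two sums agree at `v`.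
    by_cases h2 : v.2 = 0
    · have hu0 : u₀ = 0 := by rw [hu₀, h2, zero_div]
      set G : ℂ → ℂ := fun y => ∑ j, Q j * fib j (v.1, v.2 + v.1 * y) -
        ∑ j, P j * fib j (v.1, v.2 + v.1 * y) with hG
      have hGc : Continuous G := by
        refine (continuous_finsetSum _ fun j _ => ?_).sub (continuous_finsetSum _ fun j _ => ?_) <;>
        · have := hcont j
          fun_prop
      have e1 : Tendsto G (𝓝[≠] 0) (𝓝 (G 0)) := (hGc.tendsto 0).mono_left nhdsWithin_le_nhds
      have e2 : Tendsto (fun y => y ^ σ * (v.1 ^ k * h (u₀ + y))) (𝓝[≠] 0) (𝓝 0) := by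
        have := ((continuousAt_id.pow σ).mul hgc).tendsto
        simp only [id, ne_eq, hσ, not_false_eq_true, zero_pow, zero_mul, Pi.mul_apply,
          Pi.pow_apply] at this
        exact this.mono_left nhdsWithin_le_nhds
      have e3 : Tendsto G (𝓝[≠] 0) (𝓝 0) := by
        refine e2.congr' ?_
        filter_upwards [hg.filter_mono nhdsWithin_le_nhds, self_mem_nhdsWithin] with y hy hy0
        rw [hu0, zero_add] at hy
        refine mul_left_cancel₀ hy0 ?_
        rw [hu0, zero_add, ← mul_assoc, ← pow_succ', ← hy]
      have := tendsto_nhds_unique e1 e3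
      simp only [hG, mul_zero, add_zero, sub_eq_zero] at this
      rw [← hPv, this]
    · have h1 := congrArg Prod.snd hdir.2
      simp only [shadowMap, Prod.smul_snd, smul_eq_mul] at h1
      exact mul_left_cancel₀ h2 (by rw [h1, mul_comm])
  exact exists_basin hF0 hF hPQ hs hshadow hk hσ hhom hcont hv hPv hQv hgc hg0 hg h_one h_lt hatt

theorem IsShadowed.swap {n r k l : ℕ} {F Φ : (Fin n → ℂ) → (Fin n → ℂ)} {lam : Fin n → ℂ}
    {P Q : Fin n → ℕ} {fib : Fin n → ℂ × ℂ → ℂ} (h : IsShadowed F lam r P Q fib k l Φ) :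
    IsShadowed F lam r Q P (fun j u => fib j u.swap) k l Φ := by
  have hn : ∀ w : Fin n → ℂ, ‖resMono Q P w‖ = ‖resMono P Q w‖ := fun w => max_comm _ _
  refine ⟨h.map_zero, h.continuous, h.le_map, h.bound, ?_, fun j hj => ?_, h.contract⟩
  · simp only [hn]
    refine IsBigO.trans (IsBigO.of_bound 1 (Eventually.of_forall fun z => ?_)) h.base
    rw [one_mul]
    exact (max_comm _ _).le
  · simp only [hn]
    exact h.fiber j hj

theorem fiberTerm_mul {n : ℕ} (lam : Fin n → ℂ) (k₀ : ℕ) (a : ℕ × ℕ → Fin n → ℂ) (j : Fin n)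
    (c : ℂ) (u : ℂ × ℂ) :
    fiberTerm lam k₀ a j (c * u.1, c * u.2) = c ^ k₀ * fiberTerm lam k₀ a j u := by
  simp only [fiberTerm, Finset.mul_sum]
  refine Finset.sum_congr rfl fun k hk => ?_
  rw [← Finset.HasAntidiagonal.mem_antidiagonal.1 hk]
  ring

theorem analyticAt_fiberTerm {n : ℕ} (lam : Fin n → ℂ) (k₀ : ℕ) (a : ℕ × ℕ → Fin n → ℂ)
    (j : Fin n) (u : ℂ × ℂ) : AnalyticAt ℂ (fiberTerm lam k₀ a j) u :=
  Finset.analyticAt_fun_sum _ fun _ _ =>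
    (analyticAt_const.mul (analyticAt_fst.pow _)).mul (analyticAt_snd.pow _)

/-- The sums over the first `r` indices extend to all indices because `P` and `Q` vanish beyond `r`.
-/
theorem shadowTerm_eq {n r : ℕ} (lam : Fin n → ℂ) {P Q : Fin n → ℕ} (k₀ : ℕ)
    (a : ℕ × ℕ → Fin n → ℂ) (hs : ∀ j : Fin n, r ≤ j.val → P j = 0 ∧ Q j = 0) :
    shadowTerm lam r P Q k₀ a = shadowMap P Q (fiberTerm lam k₀ a) := by
  have key : ∀ (L : Fin n → ℕ), (∀ j : Fin n, r ≤ j.val → L j = 0) → ∀ u : ℂ × ℂ,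
      ∑ k ∈ Finset.HasAntidiagonal.antidiagonal k₀,
        (∑ j : Fin n with j.val < r, (L j : ℂ) * (a k j / lam j)) * u.1 ^ k.1 * u.2 ^ k.2 =
      ∑ j, (L j : ℂ) * fiberTerm lam k₀ a j u := by
    intro L hL u
    simp only [fiberTerm, Finset.mul_sum, Finset.sum_mul]
    rw [Finset.sum_comm, Finset.sum_filter]
    refine Finset.sum_congr rfl fun j _ => ?_
    split_ifs with hj
    · exact Finset.sum_congr rfl fun k _ => by ring
    · simp [hL j (not_lt.1 hj)]
  funext u
  simp only [shadowTerm, shadowMap, key P (fun j hj => (hs j hj).1),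
    key Q (fun j hj => (hs j hj).2)]

end TwoResonant

end

/-- The basin is found inside any prescribed neighbourhood `W` of the origin, so that it does not
depend on the representative of the germ `F`. -/
theorem theorem1p2 {n : ℕ} (r : ℕ) (hr : 1 ≤ r) (hrn : r ≤ n)
    (F : (Fin n → ℂ) → (Fin n → ℂ)) (hF : TwoResonant.IsGermBiholo F)
    (lam : Fin n → ℂ) (hlam : TwoResonant.HasEigenvalues F lam)
    (P Q : Fin n → ℕ) (hPQ : TwoResonant.AreGenerators lam r P Q)
    (h_one : ∀ j : Fin n, j.val < r → ‖lam j‖ = 1)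
    (h_lt : ∀ j : Fin n, r ≤ j.val → ‖lam j‖ < 1)
    (h_shadow : ∃ (k₀ : ℕ) (a : ℕ × ℕ → Fin n → ℂ) (v : ℂ × ℂ),
      TwoResonant.IsShadowData F lam r P Q k₀ a ∧
      TwoResonant.IsIrregularNondegenerate lam r P Q k₀ a v ∧
      TwoResonant.IsParabolicallyAttracting lam r P Q k₀ a v) :
    ∀ W ∈ 𝓝 (0 : Fin n → ℂ), ∃ V ⊆ W, TwoResonant.IsBasinAtBoundary F V := by
  obtain ⟨k₀, a, v, hdata, ⟨hdir, hirr⟩, -, hatt⟩ := h_shadow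
  have hlam0 : ∀ j : Fin n, j.val < r → lam j ≠ 0 := fun j hj =>
    norm_pos_iff.1 (by rw [h_one j hj]; exact one_pos)
  have hk : k₀ ≠ 0 := Nat.one_le_iff_ne_zero.1 hdata.1
  have hshadow := TwoResonant.exists_isShadowed hr hrn hPQ hlam0 hdata
  rw [TwoResonant.shadowTerm_eq lam k₀ a hPQ.1] at hdir hirr
  rcases hirr with ⟨hv, hirr⟩ | ⟨hv1, hv2, hirr⟩
  · exact TwoResonant.exists_basin_of_irregularAt hF.1 hF.2.1 hPQ.2.1 hPQ.1 hshadow hk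
      (TwoResonant.fiberTerm_mul lam k₀ a) (TwoResonant.analyticAt_fiberTerm lam k₀ a) hv hdir hirr
      h_one h_lt hatt
  -- The direction `[0 : 1]` becomes `[1 : 0]` after exchanging `P` and `Q`.
  · refine TwoResonant.exists_basin_of_irregularAt (v := v.swap) (P := Q) (Q := P)
      (fib := fun j u => TwoResonant.fiberTerm lam k₀ a j u.swap) hF.1 hF.2.1 hPQ.swap.2.1
      hPQ.swap.1 (fun l => ?_) hk (fun j c u => ?_) (fun j u => ?_) hv2 ?_ ?_ h_one h_lt ?_
    · obtain ⟨l', Φ, hl, hΦ⟩ := hshadow l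
      exact ⟨l', Φ, hl, hΦ.swap⟩
    · exact TwoResonant.fiberTerm_mul lam k₀ a j c u.swap
    · exact (TwoResonant.analyticAt_fiberTerm lam k₀ a j u.swap).comp
        (analyticAt_snd.prod analyticAt_fst)
    · refine ⟨fun h => hdir.1 (Prod.swap_injective h), ?_⟩
      have := congrArg Prod.swap hdir.2
      exact this
    · have h0 : v.swap.2 / v.swap.1 = 0 := by simp [hv1]
      rw [h0]
      exact hirr
    · exact hatt
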